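/- Let $k\ge 2$ be an integer, $q=e^{2\pi i\tau}$ with $\operatorname{Im}\tau>0$, and $q^r=e^{2\pi i r\tau}$ for real $r$. Write $(a;q)_n=\prod_{j=0}^{n-1}(1-aq^j)$, and for $1\le i\le k$ let $$x_{2k,i}(q)=\sum_{n_1,\dots,n_{k-1}\ge 0}\frac{q^{N_1^2+\cdots+N_{k-1}^2+N_i+\cdots+N_{k-1}}}{(q;q)_{n_1}\cdots(q;q)_{n_{k-2}}\,(q^2;q^2)_{n_{k-1}}},\qquad N_j=n_j+\cdots+n_{k-1},\quad N_k=0$$ (this series converges absolutely for $|q|<1$). Let $s_k$ and $t_k$ be the largest even and the largest odd integer less than $k$, let $\widetilde t_k$ be the largest odd integer not exceeding $k$, and put $$X_{2k}^{(0)}(\tau)=q^{-1/24}\Big(x_{2k,k}(q),\,q^{2^2/(4k)}x_{2k,k-2}(q),\dots,q^{s_k^2/(4k)}x_{2k,k-s_k}(q)\Big)^{\mathrm T},$$ $$X_{2k}^{(1)}(\tau)=q^{-1/24}\Big(q^{1/(4k)}x_{2k,k-1}(q),\,q^{3^2/(4k)}x_{2k,k-3}(q),\dots,q^{t_k^2/(4k)}x_{2k,k-t_k}(q)\Big)^{\mathrm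 T}.$$ Let $\Lambda_k=\mathrm{diag}\big(e^{\pi i/(2k)},e^{9\pi i/(2k)},\dots,e^{t_k^2\pi i/(2k)}\big)$ and $\widetilde\Lambda_k=\mathrm{diag}\big(e^{-\pi i/(2k)},e^{-9\pi i/(2k)},\dots,e^{-\widetilde t_k^2\pi i/(2k)}\big)$. Let $A_k$ be the $\lfloor k/2\rfloor\times\lfloor k/2\rfloor$ matrix with entries $\cos\frac{(2i-1)(2j-1)\pi}{2k}$, and let $B_k=(b_{ij})$, $C_k=(c_{ij})$ be the $\lfloor (k+1)/2\rfloor\times\lfloor (k+1)/2\rfloor$ matrices with $b_{ij}=\tfrac12\cos((i-1)\pi)$ if $k$ is odd and $j=\frac{k+1}{2}$, $b_{ij}=\cos\frac{(i-1)(2j-1)\pi}{k}$ otherwise; $c_{i1}=\tfrac12$, and $c_{ij}=\cos\frac{(2i-1)(j-1)\pi}{k}$ for $j\ge 2$. Then for all $\tau$ with $\operatorname{Im}\tau>0$, $$X_{2k}^{(0)}(\tau+1)=e^{-\pi i/12}\,\mathrm{diag}\big(1,e^{2^2\pi i/(2k)},\dots,e^{s_k^2\pi i/(2k)}\big)X_{2k}^{(0)}(\tau),\qquad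 X_{2k}^{(1)}(\tau+1)=e^{-\pi i/12}\Lambda_kX_{2k}^{(1)}(\tau),$$ $$X_{2k}^{(0)}\Big(\frac{\tau}{4\tau+1}\Big)=\frac4k e^{\pi i/3}B_k\widetilde\Lambda_kC_kX_{2k}^{(0)}(\tau),\qquad X_{2k}^{(1)}\Big(\frac{\tau}{4\tau+1}\Big)=\frac4k e^{\pi i/3}A_k\Lambda_k^{-1}A_kX_{2k}^{(1)}(\tau).$$ Moreover, $X_{2k}^{(0)}$ and $X_{2k}^{(1)}$ are vector-valued modular functions on $\Gamma_0(4)$: each such $X$, with $d$ components, is holomorphic on the upper half plane, there is a homomorphism $\rho:\Gamma_0(4)\to \mathrm{GL}_d(\mathbb C)$ with $X(\gamma\tau)=\rho(\gamma)X(\tau)$ for all $\gamma\in\Gamma_0(4)$, and $X$ is meromorphic at the cusps, i.e. for every $\gamma\in\mathrm{SL}(2,\mathbb Z)$ there are integers $h\ge 1$ and $N\ge 0$ such that $X(\gamma\tau)$ is invariant under $\tau\mapsto\tau+h$ and $q^NX(\gamma\tau)$ is bounded as $\operatorname{Im}\tau\to\infty$. -/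

import Mathlib

open scoped MatrixGroups Manifold

noncomputable section

namespace BressoudVec

/-- The finite `q`-shifted factorial `(a; q)_n = ∏_{j < n} (1 - a q^j)`. -/
def qPoch (a q : ℂ) (n : ℕ) : ℂ := ∏ j ∈ Finset.range n, (1 - a * q ^ j)

/-- `N_j = n_j + ⋯ + n_{k-1}` for `j ≥ 1` (so `N_k = 0`). The coordinate `l : Fin (k - 1)` of `n`
is `n_{l+1}`. -/
def partialSum (k : ℕ) (n : Fin (k - 1) → ℕ) (j : ℕ) : ℕ :=
  ∑ l : Fin (k - 1), if j ≤ (l : ℕ) + 1 then n l else 0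

/-- The exponent `N_1² + ⋯ + N_{k-1}² + N_i + ⋯ + N_{k-1}`. -/
def exponent (k i : ℕ) (n : Fin (k - 1) → ℕ) : ℕ :=
  ∑ j ∈ Finset.Icc 1 (k - 1), partialSum k n j ^ 2 + ∑ j ∈ Finset.Icc i (k - 1), partialSum k n j

/-- The denominator `(q; q)_{n_1} ⋯ (q; q)_{n_{k-2}} (q²; q²)_{n_{k-1}}`. -/
def denom (k : ℕ) (q : ℂ) (n : Fin (k - 1) → ℕ) : ℂ :=
  ∏ l : Fin (k - 1), if (l : ℕ) + 1 = k - 1 then qPoch (q ^ 2) (q ^ 2) (n l) else qPoch q q (n l)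

/-- The general term of Bressoud's Nahm sum `x_{2k,i}(q)`. -/
def term (k i : ℕ) (q : ℂ) (n : Fin (k - 1) → ℕ) : ℂ := q ^ exponent k i n / denom k q n

/-- Bressoud's Nahm sum `x_{2k,i}(q)`. -/
def nahmSum (k i : ℕ) (q : ℂ) : ℂ := ∑' n : Fin (k - 1) → ℕ, term k i q n

/-- `q^r = e^{2πi r τ}` for a real exponent `r`, where `q = e^{2πiτ}`. -/
def qpow (r : ℝ) (τ : ℂ) : ℂ := Complex.exp (2 * Real.pi * Complex.I * r * τ)

/-- The component of index `s` (even or odd, `0 ≤ s < k`) of the vectors below: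
`q^{-1/24} q^{s²/(4k)} x_{2k,k-s}(q)`. -/
def component (k s : ℕ) (τ : ℂ) : ℂ :=
  qpow (-1 / 24) τ * qpow ((s : ℝ) ^ 2 / (4 * k)) τ * nahmSum k (k - s) (qpow 1 τ)

/-- `X_{2k}^{(0)}(τ)`: the components with `s = 0, 2, …, s_k`, where `s_k` is the largest even
number less than `k`. There are `⌊(k+1)/2⌋` of them. -/
def X0 (k : ℕ) (τ : ℂ) : Fin ((k + 1) / 2) → ℂ := fun j => component k (2 * (j : ℕ)) τ

/-- `X_{2k}^{(1)}(τ)`: the components with `s = 1, 3, …, t_k`, where `t_k` is the largest odd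
number less than `k`. There are `⌊k/2⌋` of them. -/
def X1 (k : ℕ) (τ : ℂ) : Fin (k / 2) → ℂ := fun j => component k (2 * (j : ℕ) + 1) τ

/-- `diag(1, e^{2²πi/(2k)}, …, e^{s_k²πi/(2k)})`. -/
def evenT (k : ℕ) : Matrix (Fin ((k + 1) / 2)) (Fin ((k + 1) / 2)) ℂ :=
  Matrix.diagonal fun j => Complex.exp ((2 * (j : ℕ)) ^ 2 * Real.pi * Complex.I / (2 * k))

/-- `Λ_k = diag(e^{πi/(2k)}, e^{9πi/(2k)}, …, e^{t_k²πi/(2k)})`. -/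
def Lam (k : ℕ) : Matrix (Fin (k / 2)) (Fin (k / 2)) ℂ :=
  Matrix.diagonal fun j => Complex.exp ((2 * (j : ℕ) + 1) ^ 2 * Real.pi * Complex.I / (2 * k))

/-- `Λ̃_k = diag(e^{-πi/(2k)}, e^{-9πi/(2k)}, …, e^{-t̃_k²πi/(2k)})`, where `t̃_k` is the largest odd
number not exceeding `k`. -/
def LamTilde (k : ℕ) : Matrix (Fin ((k + 1) / 2)) (Fin ((k + 1) / 2)) ℂ :=
  Matrix.diagonal fun j =>
    Complex.exp (-((2 * (j : ℕ) + 1) ^ 2 * Real.pi * Complex.I / (2 * k)))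

/-- `A_k`, with entries `cos((2i-1)(2j-1)π/(2k))` for `1 ≤ i, j ≤ ⌊k/2⌋`
(here and below the indices of the code start at `0`). -/
def matA (k : ℕ) : Matrix (Fin (k / 2)) (Fin (k / 2)) ℂ :=
  Matrix.of fun i j =>
    ((Real.cos ((2 * (i : ℕ) + 1) * (2 * (j : ℕ) + 1) * Real.pi / (2 * k)) : ℝ) : ℂ)

/-- `B_k`, with entries `cos((i-1)(2j-1)π/k)`, `1 ≤ i, j ≤ ⌊(k+1)/2⌋`, except that the entries are
`cos((i-1)π)/2` in the last column `j = (k+1)/2` if `k` is odd. -/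
def matB (k : ℕ) : Matrix (Fin ((k + 1) / 2)) (Fin ((k + 1) / 2)) ℂ :=
  Matrix.of fun i j =>
    if Odd k ∧ (j : ℕ) + 1 = (k + 1) / 2 then ((1 / 2 * Real.cos ((i : ℕ) * Real.pi) : ℝ) : ℂ)
    else ((Real.cos ((i : ℕ) * (2 * (j : ℕ) + 1) * Real.pi / k) : ℝ) : ℂ)

/-- `C_k`, with entries `1/2` in the first column and `cos((2i-1)(j-1)π/k)` for
`2 ≤ j ≤ ⌊(k+1)/2⌋`. -/
def matC (k : ℕ) : Matrix (Fin ((k + 1) / 2)) (Fin ((k + 1) / 2)) ℂ :=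
  Matrix.of fun i j =>
    if (j : ℕ) = 0 then 1 / 2
    else ((Real.cos ((2 * (i : ℕ) + 1) * (j : ℕ) * Real.pi / k) : ℝ) : ℂ)

/-- A (weight zero, weakly holomorphic) vector-valued modular function on `Γ ≤ SL(2, ℤ)`:
it is holomorphic on the upper half plane, transforms under `Γ` by a representation, and is
meromorphic at every cusp. The last condition says that for each `γ ∈ SL(2, ℤ)` the function
`F(γτ)` is periodic with some positive integer period `h` and becomes bounded at `i∞` after
multiplication by some power `q^N`; so it is a Laurent series in `q^{1/h}` with finite principal
part. -/
structure IsVectorValuedModularFunction {ι : Type*} [Fintype ι] [DecidableEq ι]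
    (Γ : Subgroup SL(2, ℤ)) (F : UpperHalfPlane → ι → ℂ) : Prop where
  holomorphic : ∀ i, MDifferentiable 𝓘(ℂ) 𝓘(ℂ) fun τ => F τ i
  transform : ∃ ρ : Γ →* GL ι ℂ, ∀ (γ : Γ) (τ : UpperHalfPlane),
    F ((γ : SL(2, ℤ)) • τ) = (ρ γ : Matrix ι ι ℂ).mulVec (F τ)
  meromorphic_cusps : ∀ γ : SL(2, ℤ), ∃ h N : ℕ, 0 < h ∧
    (∀ τ : UpperHalfPlane, F (γ • ((h : ℝ) +ᵥ τ)) = F (γ • τ)) ∧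
    ∀ i, UpperHalfPlane.IsBoundedAtImInfty fun τ : UpperHalfPlane =>
      Complex.exp (2 * Real.pi * Complex.I * N * (τ : ℂ)) * F (γ • τ) i

end BressoudVec

end

noncomputable section

namespace BressoudVec

open Filter Topology

/-! Bressoud's identity writes each component as a theta series divided by `η`; the transformation
laws then come from Poisson summation.

For the identity, weight the summand of `x_{2k,k-s}` by `1/(q;q)_{L-N_1}`. The resulting sums
`truncSum` and the bilateral sums `baileySum` obey the same recursion as variables are added: for
the former by splitting off `n_1`, for the latter by the Bailey lemma, a consequence of
`qVandermonde`. The recursion starts at `baileySum_one_zero`. Letting `L → ∞` gives `x_{2k,k-s}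
(q;q)_∞ = ∑_j (-1)^j q^(k j² + s j)` (`nahmSum_mul_tprod`), hence `component_eq`: component `s` is
`η⁻¹ ∑_n (-1)^n q^((2kn+s)²/(4k))`.

Under `τ ↦ -1/τ` (`latticeTheta_neg_one_div`) the sign character and the residue exchange roles, and
the scale `2k` becomes `8k`; the factor of weight 1/2 cancels against that of `η`. Pairing the
residues `b` and `2k - b` produces the cosines, and unpaired residues produce the entries with
factor 1/2 in `B_k` and `C_k`. The dual vectors so obtained are multiplied by a diagonal matrix
under `τ ↦ τ - 4`. Since `τ/(4τ+1) = -1/(-1/τ - 4)`, the law for this map is a product of three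
matrices.

The group `Γ_0(4)` is generated by `T`, `[[1,0],[4,1]]` and `-1` (`Gamma0_four_le`). The components
have distinct leading exponents at `i∞`, so they are linearly independent
(`eq_zero_of_sum_thetaQuot_eq_zero`); the transformation matrices are therefore unique and
invertible and form a representation. At the cusps, the components lie in a space of theta quotients
stable under all of `SL(2, ℤ)` (`stableSubgroup_thetaSpan`), each member of which has period `48k`
and is `O(q⁻¹)`. -/

/-! ### Finite `q`-series: the `q`-Vandermonde sum and the Bailey lemma -/

/-- The reciprocal `1 / (q; q)_m`, extended by zero to negative integers `m`. -/
def qRecip (q : ℂ) (m : ℤ) : ℂ := if 0 ≤ m then (qPoch q q m.toNat)⁻¹ else 0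

lemma qRecip_natCast (q : ℂ) (n : ℕ) : qRecip q n = (qPoch q q n)⁻¹ := by
  simp [qRecip]

lemma qRecip_of_neg (q : ℂ) {m : ℤ} (hm : m < 0) : qRecip q m = 0 := by
  simp [qRecip, hm]

lemma qPoch_succ (a q : ℂ) (n : ℕ) : qPoch a q (n + 1) = qPoch a q n * (1 - a * q ^ n) := by
  simp [qPoch, Finset.prod_range_succ]

lemma one_sub_pow_ne_zero {q : ℂ} (hq : ‖q‖ < 1) {n : ℕ} (hn : n ≠ 0) : 1 - q ^ n ≠ 0 := by
  intro h
  have h1 : q ^ n = 1 := (sub_eq_zero.mp h).symm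
  have h2 : ‖q‖ ^ n = 1 := by rw [← norm_pow, h1, norm_one]
  exact absurd h2 (pow_lt_one₀ (norm_nonneg _) hq hn).ne

lemma qRecip_rec {q : ℂ} (hq : ‖q‖ < 1) (m : ℤ) :
    (1 - q ^ m) * qRecip q m = qRecip q (m - 1) := by
  rcases lt_trichotomy m 0 with h | h | h
  · rw [qRecip_of_neg q h, qRecip_of_neg q (by omega), mul_zero]
  · subst h
    rw [qRecip_of_neg q (show (0 : ℤ) - 1 < 0 by omega)]
    simp
  · obtain ⟨n, rfl⟩ : ∃ n : ℕ, m = n + 1 := ⟨(m - 1).toNat, by omega⟩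
    have h1 : ((n : ℤ) + 1) = ((n + 1 : ℕ) : ℤ) := by push_cast; ring
    rw [add_sub_cancel_right, qRecip_natCast, h1, qRecip_natCast, zpow_natCast, qPoch_succ,
      ← pow_succ', mul_inv, mul_comm (qPoch q q n)⁻¹,
      mul_inv_cancel_left₀ (one_sub_pow_ne_zero hq n.succ_ne_zero)]

/-- Induction on `n` with `d` free: after multiplication by `1 - q^(n+1)`, one part of the sum is
the case `(n, d)` and the other, shifted by one in `t`, is the case `(n, d + 1)`. -/
lemma qVandermonde {q : ℂ} (hq : ‖q‖ < 1) (n d : ℕ) :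
    ∑ t ∈ Finset.range (n + 1), q ^ (t * (t + d)) * qRecip q (n - t : ℤ) * qRecip q t *
      qRecip q (t + d : ℤ) = qRecip q n * qRecip q (n + d : ℤ) := by
  induction n generalizing d with
  | zero => simp [qRecip, qPoch]
  | succ n ih =>
    have hne : (1 - q ^ (n + 1)) ≠ 0 := one_sub_pow_ne_zero hq n.succ_ne_zero
    apply mul_left_cancel₀ hne
    -- This is `1 - q^(n+1) = (1 - q^(n+1-t)) + q^(n+1-t) (1 - q^t)`, each bracket being absorbed by
    -- one reciprocal.
    have hsplit : ∀ t ∈ Finset.range (n + 1 + 1), (1 - q ^ (n + 1)) * (q ^ (t * (t + d)) *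
        qRecip q (((n + 1 : ℕ) : ℤ) - t) * qRecip q t * qRecip q (t + d : ℤ)) =
        q ^ (t * (t + d)) * qRecip q (n - t : ℤ) * qRecip q t * qRecip q (t + d : ℤ) +
        q ^ (n + 1 - t) * q ^ (t * (t + d)) * qRecip q (((n + 1 : ℕ) : ℤ) - t) *
          qRecip q (t - 1 : ℤ) * qRecip q (t + d : ℤ) := by
      intro t ht
      have htn : t ≤ n + 1 := by simpa [Nat.lt_succ_iff] using ht
      have e1 := qRecip_rec hq (((n + 1 : ℕ) : ℤ) - t)
      have e2 := qRecip_rec hq (t : ℤ)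
      have e3 : (((n + 1 : ℕ) : ℤ) - t) = ((n + 1 - t : ℕ) : ℤ) := by omega
      have e4 : (((n + 1 : ℕ) : ℤ) - t - 1) = n - t := by omega
      have e5 : q ^ (n + 1) = q ^ (n + 1 - t) * q ^ t := by rw [← pow_add]; congr 1; omega
      rw [e4, e3, zpow_natCast] at e1
      rw [zpow_natCast] at e2
      rw [← e1, ← e2, e3, e5]
      ring
    rw [Finset.mul_sum, Finset.sum_congr rfl hsplit, Finset.sum_add_distrib,
      Finset.sum_range_succ, Finset.sum_range_succ' _ (n + 1)]
    have z1 : qRecip q ((n : ℤ) - ((n + 1 : ℕ) : ℤ)) = 0 := qRecip_of_neg q (by omega)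
    have z2 : qRecip q (((0 : ℕ) : ℤ) - 1) = 0 := qRecip_of_neg q (by omega)
    rw [z1, z2, ih d]
    have hshift : ∑ t ∈ Finset.range (n + 1), q ^ (n + 1 - (t + 1)) *
        q ^ ((t + 1) * (t + 1 + d)) * qRecip q (((n + 1 : ℕ) : ℤ) - ((t + 1 : ℕ) : ℤ)) *
        qRecip q (((t + 1 : ℕ) : ℤ) - 1) * qRecip q (((t + 1 : ℕ) : ℤ) + d) =
        q ^ (n + 1 + d) * (qRecip q n * qRecip q (n + (d + 1 : ℕ) : ℤ)) := by
      rw [← ih (d + 1), Finset.mul_sum]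
      refine Finset.sum_congr rfl fun t ht => ?_
      have htn : t ≤ n := by simpa [Nat.lt_succ_iff] using ht
      have e1 : (((n + 1 : ℕ) : ℤ) - ((t + 1 : ℕ) : ℤ)) = n - t := by omega
      have e2 : (((t + 1 : ℕ) : ℤ) - 1) = t := by omega
      have e3 : (((t + 1 : ℕ) : ℤ) + d) = t + (d + 1 : ℕ) := by omega
      have e4 : q ^ (n + 1 - (t + 1)) * q ^ ((t + 1) * (t + 1 + d)) =
          q ^ (n + 1 + d) * q ^ (t * (t + (d + 1))) := by
        obtain ⟨s, rfl⟩ := Nat.exists_eq_add_of_le htn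
        rw [← pow_add, ← pow_add, show t + s + 1 - (t + 1) = s by omega]
        congr 1; ring
      rw [e1, e2, e3, e4]
      ring
    rw [hshift]
    have r1 := qRecip_rec hq ((n + 1 : ℕ) : ℤ)
    have r2 := qRecip_rec hq ((n + 1 + d : ℕ) : ℤ)
    rw [zpow_natCast] at r1 r2
    rw [show (((n + 1 : ℕ) : ℤ) - 1) = n by omega] at r1
    rw [show (((n + 1 + d : ℕ) : ℤ) - 1) = n + d by omega] at r2
    rw [show (n + (d + 1 : ℕ) : ℤ) = ((n + 1 + d : ℕ) : ℤ) by omega,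
      show (((n + 1 : ℕ) : ℤ) + d) = ((n + 1 + d : ℕ) : ℤ) by omega, ← r1, ← r2]
    ring

/-- The kernel of the Bailey lemma with parameter `a = q^e`. Only `r = j + t` with `t ≥ 0`
contributes, and the sum over `t` is `qVandermonde` with `d = 2j + e`. -/
lemma sum_qRecip_mul {q : ℂ} (hq : ‖q‖ < 1) (L j e : ℕ) :
    ∑ r ∈ Finset.range (L + 1), q ^ (r ^ 2 + e * r) * qRecip q (L - r : ℤ) *
      (qRecip q (r - j : ℤ) * qRecip q (r + j + e : ℤ)) =
      q ^ (j ^ 2 + e * j) * (qRecip q (L - j : ℤ) * qRecip q (L + j + e : ℤ)) := by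
  rcases lt_or_ge L j with h | h
  · rw [qRecip_of_neg q (show (L - j : ℤ) < 0 by omega), zero_mul, mul_zero]
    refine Finset.sum_eq_zero fun r hr => ?_
    rw [Finset.mem_range] at hr
    rw [qRecip_of_neg q (show (r - j : ℤ) < 0 by omega), zero_mul, mul_zero]
  · obtain ⟨n, rfl⟩ := Nat.exists_eq_add_of_le h
    have hv := qVandermonde hq n (2 * j + e)
    rw [show j + n + 1 = j + (n + 1) by ring, Finset.sum_range_add, Finset.sum_eq_zero, zero_add]
    · rw [show (((j + n : ℕ) : ℤ) - j) = n by omega,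
        show (((j + n : ℕ) : ℤ) + j + e) = n + (2 * j + e : ℕ) by omega, ← hv, Finset.mul_sum]
      refine Finset.sum_congr rfl fun t _ => ?_
      rw [show (((j + n : ℕ) : ℤ) - (j + t : ℕ)) = n - t by omega,
        show (((j + t : ℕ) : ℤ) - j) = t by omega,
        show (((j + t : ℕ) : ℤ) + j + e) = t + (2 * j + e : ℕ) by omega,
        show (j + t) ^ 2 + e * (j + t) = (j ^ 2 + e * j) + t * (t + (2 * j + e)) by ring, pow_add]
      ring
    · intro r hr
      rw [Finset.mem_range] at hr
      rw [qRecip_of_neg q (show (r - j : ℤ) < 0 by omega), zero_mul, mul_zero]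

/-- The bilateral sum `∑_j (-1)^j q^(A j² + B j) / ((q; q)_{L-j} (q; q)_{L+j})`. -/
def baileySum (q : ℂ) (A B : ℕ) (L : ℕ) : ℂ :=
  ∑' j : ℤ, (-1) ^ j * q ^ (A * j ^ 2 + B * j : ℤ) * (qRecip q (L - j) * qRecip q (L + j))

lemma qRecip_mul_eq_zero (q : ℂ) {L : ℕ} {j : ℤ} (hj : j ∉ Finset.Icc (-(L : ℤ)) L) :
    qRecip q (L - j) * qRecip q (L + j) = 0 := by
  rw [Finset.mem_Icc, not_and_or, not_le, not_le] at hj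
  rcases hj with h | h
  · rw [qRecip_of_neg q (show (L + j : ℤ) < 0 by omega), mul_zero]
  · rw [qRecip_of_neg q (show (L - j : ℤ) < 0 by omega), zero_mul]

lemma summable_qRecip_mul (q : ℂ) (L : ℕ) (f : ℤ → ℂ) :
    Summable fun j : ℤ => f j * (qRecip q (L - j) * qRecip q (L + j)) := by
  refine summable_of_ne_finset_zero (s := Finset.Icc (-(L : ℤ)) L) fun j hj => ?_
  rw [qRecip_mul_eq_zero q hj, mul_zero]

/-- The Bailey lemma at `a = 1`, applied to each `j` separately; negative `j` reduce to positive
ones by the symmetry of the two reciprocals. -/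
lemma sum_qRecip_mul_baileySum {q : ℂ} (hq0 : q ≠ 0) (hq : ‖q‖ < 1) (A B L : ℕ) :
    ∑ r ∈ Finset.range (L + 1), q ^ (r ^ 2) * qRecip q (L - r : ℤ) * baileySum q A B r =
      baileySum q (A + 1) B L := by
  simp only [baileySum, ← tsum_mul_left]
  rw [← Summable.tsum_finsetSum]
  · refine tsum_congr fun j => ?_
    have h : ∀ j : ℕ, ∑ r ∈ Finset.range (L + 1), q ^ (r ^ 2) * qRecip q (L - r : ℤ) *
        (qRecip q (r - j : ℤ) * qRecip q (r + j : ℤ)) =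
        q ^ (j ^ 2) * (qRecip q (L - j : ℤ) * qRecip q (L + j : ℤ)) := by
      intro j
      simpa using sum_qRecip_mul hq L j 0
    have h2 : ∑ r ∈ Finset.range (L + 1), q ^ (r ^ 2) * qRecip q (L - r : ℤ) *
        (qRecip q (r - j : ℤ) * qRecip q (r + j : ℤ)) =
        q ^ (j ^ 2) * (qRecip q (L - j : ℤ) * qRecip q (L + j : ℤ)) := by
      obtain ⟨n, rfl | rfl⟩ := j.eq_nat_or_neg
      · rw [h n, ← zpow_natCast]; push_cast; rfl
      · rw [neg_sq]
        simp only [sub_neg_eq_add, ← sub_eq_add_neg]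
        simp only [mul_comm (qRecip q (_ + (n : ℤ)))]
        rw [h n, ← zpow_natCast]; push_cast; rfl
    have e : (((A + 1 : ℕ) : ℤ) * j ^ 2 + B * j) = (A * j ^ 2 + B * j) + j ^ 2 := by push_cast; ring
    rw [e, zpow_add₀ hq0 _ (j ^ 2), mul_assoc, mul_assoc, ← h2, Finset.mul_sum, Finset.mul_sum]
    refine Finset.sum_congr rfl fun r _ => ?_
    ring
  · intro r _
    exact ((summable_qRecip_mul q r _).mul_left _)

/-- Pairing `j` with `-(j + 1)`, whose exponents differ by `2j + 1`, turns a sum adapted to `a = 1`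
into one adapted to `a = q`. The brackets combine as `(1 - q^(L+j+1)) - q^(2j+1) (1 - q^(L-j)) = 1 -
q^(2j+1)`. -/
lemma baileySum_succ_eq {q : ℂ} (hq0 : q ≠ 0) (hq : ‖q‖ < 1) (m L : ℕ) :
    baileySum q (m + 1) m L = ∑' j : ℕ, (-1) ^ j * q ^ (j ^ 2 + m * (j ^ 2 + j)) *
      (1 - q ^ (2 * j + 1)) * (qRecip q (L - j : ℤ) * qRecip q (L + j + 1 : ℤ)) := by
  rw [baileySum, ((summable_qRecip_mul q L _).hasSum.nat_add_neg_add_one).tsum_eq.symm]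
  refine tsum_congr fun j => ?_
  have e1 := qRecip_rec hq (L + j + 1 : ℤ)
  have e2 := qRecip_rec hq (L - j : ℤ)
  rw [add_sub_cancel_right] at e1
  rw [show (L - -((j : ℤ) + 1) : ℤ) = L + j + 1 by ring,
    show (L + -((j : ℤ) + 1) : ℤ) = L - j - 1 by ring, ← e1, ← e2]
  have p1 : q ^ (((m + 1 : ℕ) : ℤ) * (j : ℤ) ^ 2 + m * j) = q ^ (j ^ 2 + m * (j ^ 2 + j)) := by
    rw [← zpow_natCast]; congr 1; push_cast; ring
  have p2 : q ^ (((m + 1 : ℕ) : ℤ) * (-((j : ℤ) + 1)) ^ 2 + m * (-((j : ℤ) + 1))) =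
      q ^ (j ^ 2 + m * (j ^ 2 + j)) * q ^ (2 * j + 1) := by
    rw [← zpow_natCast, ← zpow_natCast, ← zpow_add₀ hq0]; congr 1; push_cast; ring
  have p3 : q ^ (L - j : ℤ) * q ^ (2 * j + 1) = q ^ (L + j + 1 : ℤ) := by
    rw [← zpow_natCast, ← zpow_add₀ hq0]; congr 1; push_cast; ring
  have p4 : (-1 : ℂ) ^ (-((j : ℤ) + 1)) = -(-1) ^ j := by
    rw [zpow_neg, show ((j : ℤ) + 1) = ((j + 1 : ℕ) : ℤ) by push_cast; rfl, zpow_natCast, pow_succ]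
    rcases neg_one_pow_eq_or ℂ j with h | h <;> simp [h]
  rw [p1, p2, p4, zpow_natCast, ← p3]
  ring

/-- The Bailey lemma at `a = q`. It also raises the linear coefficient, and it needs the quadratic
one to exceed it by exactly one, so that the pairing applies. -/
lemma sum_qRecip_mul_baileySum_succ {q : ℂ} (hq0 : q ≠ 0) (hq : ‖q‖ < 1) (m L : ℕ) :
    ∑ r ∈ Finset.range (L + 1), q ^ (r ^ 2 + r) * qRecip q (L - r : ℤ) * baileySum q (m + 1) m r =
      baileySum q (m + 2) (m + 1) L := by
  rw [baileySum_succ_eq hq0 hq (m + 1)]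
  simp only [baileySum_succ_eq hq0 hq m, ← tsum_mul_left]
  rw [← Summable.tsum_finsetSum]
  · refine tsum_congr fun j => ?_
    have h := sum_qRecip_mul hq L j 1
    simp only [one_mul, Nat.cast_one] at h
    rw [show j ^ 2 + (m + 1) * (j ^ 2 + j) = j ^ 2 + m * (j ^ 2 + j) + (j ^ 2 + j) by ring,
      pow_add _ _ (j ^ 2 + j)]
    calc _ = (-1) ^ j * q ^ (j ^ 2 + m * (j ^ 2 + j)) * (1 - q ^ (2 * j + 1)) *
          ∑ r ∈ Finset.range (L + 1), q ^ (r ^ 2 + r) * qRecip q (L - r : ℤ) *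
            (qRecip q (r - j : ℤ) * qRecip q (r + j + 1 : ℤ)) := by
          rw [Finset.mul_sum]
          refine Finset.sum_congr rfl fun r _ => ?_
          ring
      _ = _ := by rw [h]; ring
  · intro r _
    refine summable_of_ne_finset_zero (s := Finset.range (r + 1)) fun j hj => ?_
    rw [Finset.mem_range] at hj
    rw [qRecip_of_neg q (show (r - j : ℤ) < 0 by omega)]
    ring

/-- The start of the chain, and the source of `(q²; q²)` in the last denominator. By induction on
`L`, since `(1 - q^(2(L+1))) S_(L+1) - S_L` telescopes over `j`. -/
lemma baileySum_one_zero {q : ℂ} (hq0 : q ≠ 0) (hq : ‖q‖ < 1) (L : ℕ) :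
    baileySum q 1 0 L = (qPoch (q ^ 2) (q ^ 2) L)⁻¹ := by
  induction L with
  | zero =>
    rw [baileySum, tsum_eq_single 0]
    · simp [qRecip, qPoch]
    · intro j hj
      rw [qRecip_mul_eq_zero q, mul_zero]
      simp; omega
  | succ L ih =>
    have hne : (1 - q ^ (2 * (L + 1))) ≠ 0 := one_sub_pow_ne_zero hq (by omega)
    have hP : 1 - q ^ 2 * (q ^ 2) ^ L = 1 - q ^ (2 * (L + 1)) := by ring
    rw [qPoch_succ, mul_inv, ← ih, hP]
    rw [eq_mul_inv_iff_mul_eq₀ hne]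
    rw [← sub_eq_zero, mul_comm, baileySum, baileySum, ← tsum_mul_left, ← Summable.tsum_sub]
    -- The telescoping certificate `T_j`. With `x = q^(L+1+j)` and `y = q^(L+1-j)`, the identity `(1
    -- - xy) - (1 - x)(1 - y) = y(1 - x) + x(1 - y)` makes the summand equal to `T_j - T_(j+1)`.
    · have hS : Summable fun j : ℤ => (-1) ^ j * q ^ (j ^ 2 + (L + 1) - j : ℤ) *
          (qRecip q (L + 1 - j : ℤ) * qRecip q (L + j : ℤ)) := by
        refine summable_of_ne_finset_zero (s := Finset.Icc (-(L + 1 : ℤ)) (L + 1)) fun j hj => ?_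
        rw [Finset.mem_Icc, not_and_or, not_le, not_le] at hj
        rcases hj with h | h
        · rw [qRecip_of_neg q (show (L + j : ℤ) < 0 by omega), mul_zero, mul_zero]
        · rw [qRecip_of_neg q (show (L + 1 - j : ℤ) < 0 by omega), zero_mul, mul_zero]
      have hS' := (Equiv.addRight (1 : ℤ)).summable_iff.mpr hS
      have hT := (Equiv.addRight (1 : ℤ)).tsum_eq fun j : ℤ =>
        (-1) ^ j * q ^ (j ^ 2 + (L + 1) - j : ℤ) *
          (qRecip q (L + 1 - j : ℤ) * qRecip q (L + j : ℤ))
      rw [← sub_eq_zero.mpr hT.symm]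
      refine Eq.trans (tsum_congr fun j => ?_) (hS.tsum_sub hS')
      have e1 := qRecip_rec hq (L + 1 - j : ℤ)
      have e2 := qRecip_rec hq (L + 1 + j : ℤ)
      rw [show (L + 1 - j - 1 : ℤ) = L - j by ring] at e1
      rw [show (L + 1 + j - 1 : ℤ) = L + j by ring] at e2
      simp only [Equiv.coe_addRight]
      push_cast
      rw [show (L + 1 - (j + 1) : ℤ) = L - j by ring, show (L + (j + 1) : ℤ) = L + 1 + j by ring,
        ← e1, ← e2, zpow_add₀ (show (-1 : ℂ) ≠ 0 by norm_num) j 1,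
        show ((j + 1) ^ 2 + (L + 1) - (j + 1) : ℤ) = j ^ 2 + (L + 1 + j) by ring,
        show (j ^ 2 + (L + 1) - j : ℤ) = j ^ 2 + (L + 1 - j) by ring, zpow_add₀ hq0 (j ^ 2),
        zpow_add₀ hq0 (j ^ 2)]
      have e3 : q ^ (2 * (L + 1)) = q ^ (L + 1 + j : ℤ) * q ^ (L + 1 - j : ℤ) := by
        rw [← zpow_add₀ hq0, ← zpow_natCast]; congr 1; push_cast; ring
      rw [e3, zpow_one]
      simp only [one_mul, zero_mul, add_zero]
      ring
    · exact (summable_qRecip_mul q (L + 1) _).mul_left _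
    · exact summable_qRecip_mul q L _

/-! ### Splitting off the first summation variable -/

lemma partialSum_one (d : ℕ) (n : Fin d → ℕ) : partialSum (d + 1) n 1 = ∑ l, n l := by
  simp [partialSum]

lemma partialSum_cons_one (d a : ℕ) (n : Fin d → ℕ) :
    partialSum (d + 2) (Fin.cons a n : Fin (d + 1) → ℕ) 1 = a + partialSum (d + 1) n 1 := by
  rw [partialSum_one d n]
  refine (partialSum_one (d + 1) _).trans ?_
  rw [Fin.sum_univ_succ]
  simp

lemma partialSum_cons_succ (d a : ℕ) (n : Fin d → ℕ) {j : ℕ} (hj : 1 ≤ j) :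
    partialSum (d + 2) (Fin.cons a n : Fin (d + 1) → ℕ) (j + 1) = partialSum (d + 1) n j := by
  simp only [partialSum]
  refine (Fin.sum_univ_succ _).trans ?_
  have : ¬ (j + 1 ≤ ((0 : Fin (d + 1)) : ℕ) + 1) := by simp; omega
  rw [if_neg this, zero_add]
  refine Finset.sum_congr rfl fun l _ => ?_
  simp

lemma sum_Icc_succ_succ (f : ℕ → ℕ) (a b : ℕ) :
    ∑ j ∈ Finset.Icc (a + 1) (b + 1), f j = ∑ j ∈ Finset.Icc a b, f (j + 1) := by
  rw [← Finset.sum_image (s := Finset.Icc a b) (g := fun j => j + 1) (f := f)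
    (fun x _ y _ h => Nat.succ_injective h)]
  congr 1
  simp

lemma sum_Icc_one_succ (f : ℕ → ℕ) (b : ℕ) :
    ∑ j ∈ Finset.Icc 1 (b + 1), f j = f 1 + ∑ j ∈ Finset.Icc 1 b, f (j + 1) := by
  rw [← sum_Icc_succ_succ, ← Finset.add_sum_Ioc_eq_sum_Icc (by omega)]
  rfl

lemma exponent_cons (d a i : ℕ) (n : Fin d → ℕ) (hi : 1 ≤ i) :
    exponent (d + 2) (i + 1) (Fin.cons a n : Fin (d + 1) → ℕ) =
      (a + partialSum (d + 1) n 1) ^ 2 + 0 * (a + partialSum (d + 1) n 1) +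
        exponent (d + 1) i n := by
  unfold exponent
  change ∑ j ∈ Finset.Icc 1 (d + 1), _ + ∑ j ∈ Finset.Icc (i + 1) (d + 1), _ = _ +
    (∑ j ∈ Finset.Icc 1 d, _ + ∑ j ∈ Finset.Icc i d, _)
  rw [sum_Icc_one_succ, sum_Icc_succ_succ, partialSum_cons_one]
  rw [Finset.sum_congr rfl fun j hj => by
    rw [partialSum_cons_succ d a n (Finset.mem_Icc.mp hj).1]]
  rw [Finset.sum_congr (s₁ := Finset.Icc i d) rfl fun j hj => by
    rw [partialSum_cons_succ d a n (hi.trans (Finset.mem_Icc.mp hj).1)]]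
  ring

lemma exponent_cons_one (d a : ℕ) (n : Fin d → ℕ) :
    exponent (d + 2) 1 (Fin.cons a n : Fin (d + 1) → ℕ) =
      (a + partialSum (d + 1) n 1) ^ 2 + 1 * (a + partialSum (d + 1) n 1) +
        exponent (d + 1) 1 n := by
  unfold exponent
  change ∑ j ∈ Finset.Icc 1 (d + 1), _ + ∑ j ∈ Finset.Icc 1 (d + 1), _ = _ +
    (∑ j ∈ Finset.Icc 1 d, _ + ∑ j ∈ Finset.Icc 1 d, _)
  rw [sum_Icc_one_succ, sum_Icc_one_succ, partialSum_cons_one]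
  rw [Finset.sum_congr rfl fun j hj => by
    rw [partialSum_cons_succ d a n (Finset.mem_Icc.mp hj).1]]
  rw [Finset.sum_congr (s₁ := Finset.Icc 1 d) (f := fun j => partialSum (d + 2) _ (j + 1)) rfl
    fun j hj => by rw [partialSum_cons_succ d a n (Finset.mem_Icc.mp hj).1]]
  ring

lemma denom_cons (d a : ℕ) (q : ℂ) (n : Fin (d + 1) → ℕ) :
    denom (d + 3) q (Fin.cons a n : Fin (d + 2) → ℕ) = qPoch q q a * denom (d + 2) q n := by
  unfold denom
  refine (Fin.prod_univ_succ _).trans ?_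
  have : ¬ (((0 : Fin (d + 2)) : ℕ) + 1 = d + 3 - 1) := by simp
  rw [if_neg this]
  congr 1
  refine Finset.prod_congr rfl fun l _ => ?_
  simp

lemma term_cons {d a i i' e : ℕ} (q : ℂ) (n : Fin (d + 1) → ℕ)
    (h : exponent (d + 3) i (Fin.cons a n : Fin (d + 2) → ℕ) =
      (a + partialSum (d + 2) n 1) ^ 2 + e * (a + partialSum (d + 2) n 1) +
        exponent (d + 2) i' n) :
    term (d + 3) i q (Fin.cons a n : Fin (d + 2) → ℕ) =
      q ^ ((a + partialSum (d + 2) n 1) ^ 2 + e * (a + partialSum (d + 2) n 1)) *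
        qRecip q a * term (d + 2) i' q n := by
  unfold term
  rw [h, denom_cons, pow_add _ _ (exponent _ _ _), qRecip_natCast]
  field_simp

/-! ### Convergence of the Nahm sums -/

lemma tendsto_qPoch {q : ℂ} (hq : ‖q‖ < 1) :
    Tendsto (qPoch q q) atTop (𝓝 (∏' n : ℕ, (1 - q ^ (n + 1)))) := by
  have := (ModularForm.multipliable_one_sub_pow hq).hasProd.tendsto_prod_nat
  refine this.congr fun n => ?_
  simp [qPoch, pow_succ']

lemma tprod_one_sub_pow_ne_zero {q : ℂ} (hq : ‖q‖ < 1) : ∏' n : ℕ, (1 - q ^ (n + 1)) ≠ 0 := by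
  have := tprod_one_add_ne_zero_of_summable (f := fun n : ℕ => -q ^ (n + 1)) ?_ ?_
  · simpa [sub_eq_add_neg] using this
  · intro n
    rw [← sub_eq_add_neg]
    exact one_sub_pow_ne_zero hq n.succ_ne_zero
  · simpa using (summable_nat_add_iff 1).mpr (summable_geometric_of_lt_one (norm_nonneg _) hq)

lemma exists_norm_qPoch_inv_le {q : ℂ} (hq : ‖q‖ < 1) :
    ∃ C : ℝ, 0 ≤ C ∧ ∀ n, ‖(qPoch q q n)⁻¹‖ ≤ C := by
  have h := (tendsto_qPoch hq).inv₀ (tprod_one_sub_pow_ne_zero hq)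
  obtain ⟨C, hC⟩ := (Metric.isBounded_range_of_tendsto _ h).exists_norm_le
  exact ⟨C, (norm_nonneg _).trans (hC _ ⟨0, rfl⟩), fun n => hC _ ⟨n, rfl⟩⟩

lemma exists_norm_qRecip_le {q : ℂ} (hq : ‖q‖ < 1) :
    ∃ C : ℝ, 0 ≤ C ∧ ∀ m, ‖qRecip q m‖ ≤ C := by
  obtain ⟨C, hC, h⟩ := exists_norm_qPoch_inv_le hq
  refine ⟨C, hC, fun m => ?_⟩
  unfold qRecip
  split_ifs
  · exact h _
  · simpa using hC

lemma summable_prod_pow {r : ℝ} (h0 : 0 ≤ r) (h1 : r < 1) (d : ℕ) :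
    Summable fun n : Fin d → ℕ => ∏ l, r ^ n l := by
  induction d with
  | zero => exact Summable.of_finite
  | succ d ih =>
    rw [← (Fin.consEquiv fun _ : Fin (d + 1) => ℕ).summable_iff]
    refine ((summable_geometric_of_lt_one h0 h1).mul_of_nonneg ih (fun _ => by positivity)
      (fun _ => by positivity)).congr fun p => ?_
    simp [Fin.consEquiv, Fin.prod_univ_succ]

/-- The denominators are bounded away from zero, and the exponent is at least `N_1² ≥ N_1 = ∑ n_l`,
so a product of geometric series dominates. -/
lemma summable_term (d i : ℕ) {q : ℂ} (hq : ‖q‖ < 1) : Summable (term (d + 1) i q) := by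
  obtain ⟨C, hC0, hC⟩ := exists_norm_qPoch_inv_le hq
  have hq2 : ‖q ^ 2‖ < 1 := by
    rw [norm_pow]; exact pow_lt_one₀ (norm_nonneg _) hq two_ne_zero
  obtain ⟨D, hD0, hD⟩ := exists_norm_qPoch_inv_le hq2
  have hsum := (summable_prod_pow (norm_nonneg q) hq d).mul_left ((max C D) ^ d)
  refine Summable.of_norm_bounded hsum fun n => ?_
  rw [term, div_eq_mul_inv, norm_mul, mul_comm]
  refine mul_le_mul ?_ ?_ (norm_nonneg _) (by positivity)
  · rw [denom, ← Finset.prod_inv_distrib, norm_prod]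
    refine (Finset.prod_le_prod (g := fun _ => max C D) (fun _ _ => norm_nonneg _)
      (fun l _ => ?_)).trans (by simp)
    split_ifs
    · exact (hD _).trans (le_max_right _ _)
    · exact (hC _).trans (le_max_left _ _)
  · rw [norm_pow, Finset.prod_pow_eq_pow_sum]
    refine pow_le_pow_of_le_one (norm_nonneg _) hq.le ?_
    rw [exponent]
    refine le_trans ?_ (Nat.le_add_right _ _)
    rcases d.eq_zero_or_pos with rfl | hd
    · simp
    · calc ∑ l, n l = partialSum (d + 1) n 1 := (partialSum_one d n).symm
        _ ≤ partialSum (d + 1) n 1 ^ 2 := Nat.le_self_pow two_ne_zero _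
        _ ≤ _ := Finset.single_le_sum (f := fun j => partialSum (d + 1) n j ^ 2)
          (fun _ _ => Nat.zero_le _) (Finset.mem_Icc.mpr ⟨le_rfl, hd⟩)

/-! ### The truncated Nahm sums and the Bailey chain -/

/-- The sum `x_{2k,i}` with `k = d + 1`, weighted by `1 / (q; q)_{L - N_1}`. -/
def truncSum (d i : ℕ) (q : ℂ) (L : ℕ) : ℂ :=
  ∑' n : Fin d → ℕ, term (d + 1) i q n * qRecip q (L - partialSum (d + 1) n 1 : ℤ)

lemma summable_term_mul_qRecip (d i : ℕ) {q : ℂ} (hq : ‖q‖ < 1) (m : (Fin d → ℕ) → ℤ) :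
    Summable fun n : Fin d → ℕ => term (d + 1) i q n * qRecip q (m n) := by
  obtain ⟨C, hC0, hC⟩ := exists_norm_qRecip_le hq
  refine Summable.of_norm_bounded ((summable_term d i hq).norm.mul_right C) fun n => ?_
  rw [norm_mul]
  exact mul_le_mul_of_nonneg_left (hC _) (norm_nonneg _)

lemma tsum_nat_add_eq_sum {f : ℕ → ℂ} {L N : ℕ} (h1 : ∀ r, L < r → f r = 0)
    (h2 : ∀ r, r < N → f r = 0) : ∑' a, f (a + N) = ∑ r ∈ Finset.range (L + 1), f r := by
  have hs : ∀ r ∉ Finset.range (L + 1), f r = 0 := fun r hr => h1 r (by simpa using hr)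
  have := (summable_of_ne_finset_zero hs).sum_add_tsum_nat_add N
  rw [Finset.sum_eq_zero fun r hr => h2 r (Finset.mem_range.mp hr), zero_add] at this
  rw [this, tsum_eq_sum hs]

/-- Put `r = N_1 = n_1 + N_2`: then `1/(q;q)_{n_1}` becomes `1/(q;q)_{r-N_2}`, the weight of the
shorter sum truncated at `r`. -/
lemma truncSum_succ {d i i' e : ℕ} {q : ℂ} (hq : ‖q‖ < 1)
    (h : ∀ a (n : Fin (d + 1) → ℕ), exponent (d + 3) i (Fin.cons a n : Fin (d + 2) → ℕ) =
      (a + partialSum (d + 2) n 1) ^ 2 + e * (a + partialSum (d + 2) n 1) +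
        exponent (d + 2) i' n) (L : ℕ) :
    truncSum (d + 2) i q L = ∑ r ∈ Finset.range (L + 1), q ^ (r ^ 2 + e * r) *
      qRecip q (L - r : ℤ) * truncSum (d + 1) i' q r := by
  have hsum := summable_term_mul_qRecip (d + 2) i hq fun n => L - partialSum (d + 3) n 1
  rw [truncSum, ← (Fin.consEquiv fun _ : Fin (d + 2) => ℕ).tsum_eq]
  rw [← (Fin.consEquiv fun _ : Fin (d + 2) => ℕ).summable_iff] at hsum
  rw [← (Equiv.prodComm _ _).tsum_eq]
  rw [← (Equiv.prodComm _ _).summable_iff] at hsum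
  refine hsum.tsum_prod.trans ?_
  simp only [truncSum, ← tsum_mul_left]
  rw [← Summable.tsum_finsetSum
    fun r _ => (summable_term_mul_qRecip (d + 1) i' hq fun n => _).mul_left _]
  refine tsum_congr fun n => ?_
  have key := tsum_nat_add_eq_sum (L := L) (N := partialSum (d + 2) n 1)
    (f := fun r => q ^ (r ^ 2 + e * r) * qRecip q (L - r : ℤ) *
      (term (d + 2) i' q n * qRecip q (r - partialSum (d + 2) n 1 : ℤ)))
    (fun r hr => by rw [qRecip_of_neg q (show (L - r : ℤ) < 0 by omega)]; ring)
    (fun r hr => by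
      rw [qRecip_of_neg q (show (r - partialSum (d + 2) n 1 : ℤ) < 0 by omega)]; ring)
  rw [← key]
  refine tsum_congr fun a => ?_
  simp only [Function.comp_apply, Equiv.prodComm_apply, Prod.swap_prod_mk, Fin.consEquiv,
    Equiv.coe_fn_mk]
  rw [term_cons q n (h a n), partialSum_cons_one]
  push_cast
  rw [add_sub_cancel_right]
  ring

lemma truncSum_one {i e : ℕ} {q : ℂ} (hq0 : q ≠ 0) (hq : ‖q‖ < 1)
    (h : ∀ a : ℕ, exponent 2 i (fun _ : Fin 1 => a) = a ^ 2 + e * a) (L : ℕ) :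
    truncSum 1 i q L = ∑ r ∈ Finset.range (L + 1), q ^ (r ^ 2 + e * r) *
      qRecip q (L - r : ℤ) * baileySum q 1 0 r := by
  rw [truncSum, ← (Equiv.funUnique (Fin 1) ℕ).symm.tsum_eq, tsum_eq_sum (s := Finset.range (L + 1))]
  · refine Finset.sum_congr rfl fun r _ => ?_
    have e1 : (Equiv.funUnique (Fin 1) ℕ).symm r = fun _ => r := rfl
    rw [e1, partialSum_one, term, h, baileySum_one_zero hq0 hq]
    simp [denom]
    ring
  · intro r hr
    have e1 : (Equiv.funUnique (Fin 1) ℕ).symm r = fun _ => r := rfl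
    rw [Finset.mem_range] at hr
    rw [e1, partialSum_one]
    simp only [Finset.univ_unique, Finset.sum_singleton]
    rw [qRecip_of_neg q (by omega), mul_zero]

/-- From `(A, B) = (1, 0)`, `s` steps at `a = q` lead to `(s + 1, s)`, and the remaining steps at `a
= 1` to `(k, s)`, where `k = d + 2`. -/
lemma truncSum_eq_baileySum {q : ℂ} (hq0 : q ≠ 0) (hq : ‖q‖ < 1) (d s : ℕ) (hs : s ≤ d + 1)
    (L : ℕ) : truncSum (d + 1) (d + 2 - s) q L = baileySum q (d + 2) s L := by
  induction d generalizing s L with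
  | zero =>
    interval_cases s
    · rw [truncSum_one (e := 0) hq0 hq, ← sum_qRecip_mul_baileySum hq0 hq]
      · simp
      · intro a; simp [exponent, partialSum]
    · rw [truncSum_one (e := 1) hq0 hq, ← sum_qRecip_mul_baileySum_succ hq0 hq]
      · simp
      · intro a; simp [exponent, partialSum]
  | succ d ih =>
    rcases Nat.lt_or_ge (d + 1) s with h | h
    -- Here `i = 1`: `N_1` occurs in the linear part, and what remains after splitting off `n_1`
    -- again has `i = 1`. In the other case `i ≥ 2` and `i` drops by one.
    · obtain rfl : s = d + 2 := by omega
      rw [truncSum_succ hq (i' := 1) (e := 1), ← sum_qRecip_mul_baileySum_succ hq0 hq]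
      · refine Finset.sum_congr rfl fun r _ => ?_
        rw [one_mul, ← ih (d + 1) le_rfl r]
        simp
      · intro a n
        rw [show d + 1 + 2 - (d + 2) = 1 by omega]
        exact exponent_cons_one (d + 1) a n
    · rw [truncSum_succ hq (i' := d + 2 - s) (e := 0), ← sum_qRecip_mul_baileySum hq0 hq]
      · refine Finset.sum_congr rfl fun r _ => ?_
        rw [zero_mul, add_zero, ← ih s h r]
      · intro a n
        rw [show d + 1 + 2 - s = (d + 2 - s) + 1 by omega]
        exact exponent_cons (d + 1) a (d + 2 - s) n (by omega)

/-! ### Theta series and Bressoud's identity -/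

/-- The theta series `∑_n (-1)^(σ n) exp(π i (2 K n + a)² τ / c)`. -/
def latticeTheta (K : ℕ) (c : ℝ) (σ a : ℤ) (τ : ℂ) : ℂ :=
  ∑' n : ℤ, (-1) ^ (σ * n) * Complex.exp (Real.pi * Complex.I * (2 * K * n + a) ^ 2 * τ / c)

lemma neg_one_zpow_eq_exp (m : ℤ) : (-1 : ℂ) ^ m = Complex.exp (m * (Real.pi * Complex.I)) := by
  rw [Complex.exp_int_mul, Complex.exp_pi_mul_I]

lemma neg_one_zpow_eq_exp_neg (m : ℤ) :
    (-1 : ℂ) ^ m = Complex.exp (-(m * (Real.pi * Complex.I))) := by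
  rw [Complex.exp_neg, ← neg_one_zpow_eq_exp]
  rcases Int.even_or_odd m with h | h
  · rw [h.neg_one_zpow, inv_one]
  · rw [h.neg_one_zpow, inv_neg, inv_one]

lemma latticeTheta_term (K : ℕ) (c : ℝ) (σ a : ℤ) (τ : ℂ) (n : ℤ) :
    (-1) ^ (σ * n) * Complex.exp (Real.pi * Complex.I * (2 * K * n + a) ^ 2 * τ / c) =
      Complex.exp (Real.pi * Complex.I * a ^ 2 * τ / c) *
        jacobiTheta₂_term n (-σ / 2 + 2 * K * a * τ / c) (4 * K ^ 2 * τ / c) := by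
  rw [neg_one_zpow_eq_exp_neg, jacobiTheta₂_term, ← Complex.exp_add, ← Complex.exp_add]
  congr 1
  push_cast
  ring

lemma latticeTheta_eq (K : ℕ) (c : ℝ) (σ a : ℤ) (τ : ℂ) :
    latticeTheta K c σ a τ = Complex.exp (Real.pi * Complex.I * a ^ 2 * τ / c) *
      jacobiTheta₂ (-σ / 2 + 2 * K * a * τ / c) (4 * K ^ 2 * τ / c) := by
  rw [latticeTheta, jacobiTheta₂, ← tsum_mul_left]
  exact tsum_congr fun n => latticeTheta_term K c σ a τ n

lemma im_mul_div_pos {K : ℕ} (hK : 0 < K) {c : ℝ} (hc : 0 < c) {τ : ℂ} (hτ : 0 < τ.im) :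
    0 < (4 * (K : ℂ) ^ 2 * τ / c).im := by
  rw [show 4 * (K : ℂ) ^ 2 * τ / c = ((4 * (K : ℝ) ^ 2 / c : ℝ) : ℂ) * τ by push_cast; ring,
    Complex.im_ofReal_mul]
  positivity

lemma summable_latticeTheta {K : ℕ} (hK : 0 < K) {c : ℝ} (hc : 0 < c) (σ a : ℤ) {τ : ℂ}
    (hτ : 0 < τ.im) : Summable fun n : ℤ =>
      (-1) ^ (σ * n) * Complex.exp (Real.pi * Complex.I * (2 * K * n + a) ^ 2 * τ / c) := by
  simp_rw [latticeTheta_term]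
  exact ((summable_jacobiTheta₂_term_iff _ _).mpr (im_mul_div_pos hK hc hτ)).mul_left _

lemma qpow_ne_zero (r : ℝ) (τ : ℂ) : qpow r τ ≠ 0 := Complex.exp_ne_zero _

lemma norm_qpow_one_lt {τ : ℂ} (hτ : 0 < τ.im) : ‖qpow 1 τ‖ < 1 := by
  rw [qpow, Complex.norm_exp, Real.exp_lt_one_iff]
  simp
  have := Real.pi_pos
  positivity

lemma qpow_one_zpow_mul {k : ℕ} (hk : 0 < k) (s : ℕ) (τ : ℂ) (j : ℤ) :
    qpow ((s : ℝ) ^ 2 / (4 * k)) τ * ((-1) ^ j * qpow 1 τ ^ (k * j ^ 2 + s * j : ℤ)) =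
      (-1) ^ (1 * j) * Complex.exp (Real.pi * Complex.I * (2 * k * j + (s : ℤ)) ^ 2 * τ /
        ((2 * k : ℝ) : ℂ)) := by
  rw [one_mul, mul_left_comm, qpow, qpow, ← Complex.exp_int_mul, ← Complex.exp_add]
  congr 2
  have : (k : ℂ) ≠ 0 := by exact_mod_cast hk.ne'
  push_cast
  field_simp
  ring

lemma tendsto_qRecip_sub {q : ℂ} (hq : ‖q‖ < 1) (m : ℤ) :
    Tendsto (fun L : ℕ => qRecip q (L + m)) atTop (𝓝 (∏' n : ℕ, (1 - q ^ (n + 1)))⁻¹) := by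
  have h := (tendsto_qPoch hq).inv₀ (tprod_one_sub_pow_ne_zero hq)
  have h2 : Tendsto (fun L : ℕ => (L + m).toNat) atTop atTop := by
    refine tendsto_atTop.mpr fun b => ?_
    filter_upwards [eventually_ge_atTop (b + m.natAbs)] with L hL
    omega
  refine (h.comp h2).congr' ?_
  filter_upwards [eventually_ge_atTop m.natAbs] with L hL
  rw [qRecip, if_pos (by omega)]
  rfl

/-- Limit `L → ∞` of `truncSum_eq_baileySum`, by dominated convergence: one factor `1/(q;q)_∞`
appears on the left and two on the right. -/
lemma nahmSum_mul_tprod {k s : ℕ} (hk : 2 ≤ k) (hs : s < k) {q : ℂ} (hq0 : q ≠ 0) (hq : ‖q‖ < 1)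
    (hsum : Summable fun j : ℤ => (-1) ^ j * q ^ (k * j ^ 2 + s * j : ℤ)) :
    nahmSum k (k - s) q * ∏' n : ℕ, (1 - q ^ (n + 1)) =
      ∑' j : ℤ, (-1) ^ j * q ^ (k * j ^ 2 + s * j : ℤ) := by
  obtain ⟨d, rfl⟩ : ∃ d, k = d + 2 := ⟨k - 2, by omega⟩
  set P := ∏' n : ℕ, (1 - q ^ (n + 1)) with hP
  have hP0 : P ≠ 0 := tprod_one_sub_pow_ne_zero hq
  obtain ⟨C, hC0, hC⟩ := exists_norm_qRecip_le hq
  have h1 : Tendsto (truncSum (d + 1) (d + 2 - s) q) atTop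
      (𝓝 (nahmSum (d + 2) (d + 2 - s) q * P⁻¹)) := by
    rw [nahmSum, ← tsum_mul_right]
    refine tendsto_tsum_of_dominated_convergence
      (bound := fun n : Fin (d + 1) → ℕ => ‖term (d + 2) (d + 2 - s) q n‖ * C)
      ((summable_term (d + 1) _ hq).norm.mul_right C) (fun n => ?_) (.of_forall fun L n => ?_)
    · refine Tendsto.const_mul _ ?_
      simp only [sub_eq_add_neg (_ : ℤ)]
      exact tendsto_qRecip_sub hq (-(partialSum (d + 2) n 1 : ℤ))
    · rw [norm_mul]
      exact mul_le_mul_of_nonneg_left (hC _) (norm_nonneg _)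
  have h2 : Tendsto (baileySum q (d + 2) s) atTop
      (𝓝 ((∑' j : ℤ, (-1) ^ j * q ^ (((d + 2 : ℕ) : ℤ) * j ^ 2 + s * j : ℤ)) * (P⁻¹ * P⁻¹))) := by
    rw [← tsum_mul_right]
    refine tendsto_tsum_of_dominated_convergence
      (bound := fun j : ℤ => ‖(-1) ^ j * q ^ (((d + 2 : ℕ) : ℤ) * j ^ 2 + s * j : ℤ)‖ * (C * C))
      (hsum.norm.mul_right _) (fun j => ?_) (.of_forall fun L j => ?_)
    · refine Tendsto.const_mul _ (Tendsto.mul ?_ (tendsto_qRecip_sub hq j))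
      simp only [sub_eq_add_neg (_ : ℤ)]
      exact tendsto_qRecip_sub hq (-j)
    · rw [norm_mul, norm_mul (qRecip _ _)]
      exact mul_le_mul_of_nonneg_left (mul_le_mul (hC _) (hC _) (norm_nonneg _) hC0)
        (norm_nonneg _)
  have h3 := tendsto_nhds_unique (h1.congr fun L =>
    truncSum_eq_baileySum hq0 hq d s (by omega) L) h2
  rw [← mul_assoc] at h3
  rw [mul_right_cancel₀ (inv_ne_zero hP0) h3, inv_mul_cancel_right₀ hP0]

lemma component_eq {k s : ℕ} (hk : 2 ≤ k) (hs : s < k) {τ : ℂ} (hτ : 0 < τ.im) :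
    component k s τ = latticeTheta k (2 * k) 1 s τ / ModularForm.eta τ := by
  have hk0 : 0 < k := by omega
  have hq0 : qpow 1 τ ≠ 0 := qpow_ne_zero _ _
  have hq := norm_qpow_one_lt hτ
  have hs0 : qpow ((s : ℝ) ^ 2 / (4 * k)) τ ≠ 0 := qpow_ne_zero _ _
  have hsum : Summable fun j : ℤ => (-1) ^ j * qpow 1 τ ^ (k * j ^ 2 + s * j : ℤ) := by
    rw [← summable_mul_left_iff hs0]
    simp_rw [qpow_one_zpow_mul hk0]
    have := summable_latticeTheta hk0 (show (0 : ℝ) < 2 * k by positivity) 1 s hτ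
    simpa using this
  have h := nahmSum_mul_tprod hk hs hq0 hq hsum
  have hP0 := tprod_one_sub_pow_ne_zero hq
  have heta : ModularForm.eta τ = qpow (1 / 24) τ * ∏' n : ℕ, (1 - qpow 1 τ ^ (n + 1)) := by
    rw [ModularForm.eta]
    congr 1
    · rw [Function.Periodic.qParam, qpow]; congr 1; push_cast; ring
    · refine tprod_congr fun n => ?_
      rw [ModularForm.eta_q, Function.Periodic.qParam, qpow]
      congr 3; push_cast; ring
  have hneg : qpow (-1 / 24) τ * qpow (1 / 24) τ = 1 := by
    rw [qpow, qpow, ← Complex.exp_add, ← Complex.exp_zero]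
    congr 1; push_cast; ring
  rw [heta, eq_div_iff (mul_ne_zero (qpow_ne_zero _ _) hP0), latticeTheta, component]
  calc _ = (qpow (-1 / 24) τ * qpow (1 / 24) τ) * (qpow ((s : ℝ) ^ 2 / (4 * k)) τ *
        (nahmSum k (k - s) (qpow 1 τ) * ∏' n : ℕ, (1 - qpow 1 τ ^ (n + 1)))) := by ring
    _ = _ := by
      rw [hneg, one_mul, h, ← tsum_mul_left]
      refine tsum_congr fun j => ?_
      rw [qpow_one_zpow_mul hk0]

/-! ### Symmetries, inversion and translation of the theta series -/

lemma latticeTheta_congr_char (K : ℕ) (c : ℝ) {σ σ' : ℤ} (h : Even (σ - σ')) (a : ℤ) (τ : ℂ) :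
    latticeTheta K c σ a τ = latticeTheta K c σ' a τ := by
  refine tsum_congr fun n => ?_
  congr 1
  rw [show σ * n = (σ - σ') * n + σ' * n by ring, zpow_add₀ (by norm_num),
    (h.mul_right n).neg_one_zpow, one_mul]

lemma latticeTheta_neg (K : ℕ) (c : ℝ) (σ a : ℤ) (τ : ℂ) :
    latticeTheta K c σ (-a) τ = latticeTheta K c σ a τ := by
  rw [latticeTheta, ← (Equiv.neg ℤ).tsum_eq]
  refine tsum_congr fun n => ?_
  simp only [Equiv.neg_apply, mul_neg, Int.cast_neg]
  rw [neg_one_zpow_eq_exp, neg_one_zpow_eq_exp_neg]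
  push_cast
  congr 2 <;> ring

lemma latticeTheta_add_period (K : ℕ) (c : ℝ) (σ a : ℤ) (τ : ℂ) :
    latticeTheta K c σ (a + 2 * K) τ = (-1) ^ σ * latticeTheta K c σ a τ := by
  have h := (Equiv.addRight (1 : ℤ)).tsum_eq fun n : ℤ => (-1 : ℂ) ^ (σ * n) *
    Complex.exp (Real.pi * Complex.I * (2 * K * n + a) ^ 2 * τ / c)
  rw [latticeTheta, latticeTheta, ← h, ← tsum_mul_left]
  refine tsum_congr fun n => ?_
  rw [← mul_assoc, Equiv.coe_addRight, ← zpow_add₀ (by norm_num),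
    show σ + σ * (n + 1) = σ * n + (σ + σ) by ring, zpow_add₀ (by norm_num),
    (Even.add_self σ).neg_one_zpow, mul_one]
  push_cast
  congr 2
  ring

lemma latticeTheta_sub (K : ℕ) (c : ℝ) (σ a : ℤ) (τ : ℂ) :
    latticeTheta K c σ (2 * K - a) τ = (-1) ^ σ * latticeTheta K c σ a τ := by
  rw [← latticeTheta_neg K c σ a, ← latticeTheta_add_period]
  congr 1
  ring

lemma tsum_int_eq_sum_tsum {K : ℕ} (hK : 0 < K) {f : ℤ → ℂ} (hf : Summable f) :
    ∑' m, f m = ∑ j ∈ Finset.range K, ∑' n : ℤ, f (K * n + j) := by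
  have : NeZero K := ⟨hK.ne'⟩
  have hs := (Int.divModEquiv K).symm.summable_iff.mpr hf
  rw [← (Int.divModEquiv K).symm.tsum_eq, ← (Equiv.prodComm _ _).tsum_eq]
  rw [← (Equiv.prodComm _ _).summable_iff] at hs
  refine hs.tsum_prod.trans ?_
  rw [tsum_fintype, ← Fin.sum_univ_eq_sum_range (fun j => ∑' n : ℤ, f (K * n + j))]
  refine Finset.sum_congr rfl fun j _ => tsum_congr fun n => ?_
  simp [Int.divModEquiv, mul_comm]

lemma im_neg_one_div_pos {w : ℂ} (hw : 0 < w.im) : 0 < (-1 / w).im := by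
  have : w ≠ 0 := by rintro rfl; simp at hw
  rw [neg_div, Complex.neg_im, one_div, Complex.inv_im, neg_div, neg_neg]
  exact div_pos hw (Complex.normSq_pos.mpr this)

lemma one_div_cpow_half {z : ℂ} (hz : 0 < z.re) :
    1 / (z ^ (1 / 2 : ℂ)) = (1 / z) ^ (1 / 2 : ℂ) := by
  rw [one_div, one_div z, Complex.inv_cpow]
  intro h
  rw [Complex.arg_eq_pi_iff] at h
  linarith [h.1]

/-- Poisson summation, in the form of the functional equation of `jacobiTheta₂`, gives a sum over
`m` with phase `exp(πi(2m+σ)a/(2K))`. Writing `m = Kn + j`, the phase splits off `(-1)^(an)`, so `a`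
becomes the character, while `2m + σ = 2Kn + (2j + σ)` makes `2j + σ` the residue. -/
lemma latticeTheta_neg_one_div {K : ℕ} (hK : 0 < K) {c : ℝ} (hc : 0 < c) (σ a : ℤ) {w : ℂ}
    (hw : 0 < w.im) :
    latticeTheta K c σ a (-1 / w) = (-Complex.I * w * ((c / (4 * K ^ 2) : ℝ) : ℂ)) ^ (1 / 2 : ℂ) *
      ∑ j ∈ Finset.range K, Complex.exp (Real.pi * Complex.I * (2 * j + σ) * a / (2 * K)) *
        latticeTheta K (16 * K ^ 2 / c) a (2 * j + σ) w := by
  have hK0 : (K : ℂ) ≠ 0 := by exact_mod_cast hK.ne'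
  have hc0 : (c : ℂ) ≠ 0 := by exact_mod_cast hc.ne'
  have hw0 : w ≠ 0 := by rintro rfl; simp at hw
  have hc' : (0 : ℝ) < 16 * K ^ 2 / c := by positivity
  set u : ℂ := w * ((c / (4 * K ^ 2) : ℝ) : ℂ) with hu
  have hu0 : u ≠ 0 := by
    exact mul_ne_zero hw0 (Complex.ofReal_ne_zero.mpr (by positivity))
  have huim : 0 < u.im := by
    rw [hu, Complex.im_mul_ofReal]; positivity
  have hT : 4 * (K : ℂ) ^ 2 * (-1 / w) / c = -1 / u := by
    rw [hu]; push_cast; field_simp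
  have hz : -(σ : ℂ) / 2 + 2 * K * a * (-1 / w) / c = -σ / 2 - a / (2 * K * u) := by
    rw [hu]; push_cast; field_simp; ring
  have hpre : 1 / (-Complex.I * (-1 / u)) ^ (1 / 2 : ℂ) =
      (-Complex.I * w * ((c / (4 * K ^ 2) : ℝ) : ℂ)) ^ (1 / 2 : ℂ) := by
    rw [one_div_cpow_half]
    · congr 1
      rw [mul_assoc, ← hu]
      field_simp
      simp
    · have := im_neg_one_div_pos huim
      simpa using this
  have hexp : ∀ m : ℤ, Complex.exp (Real.pi * Complex.I * a ^ 2 * (-1 / w) / c) *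
      (Complex.exp (-Real.pi * Complex.I * (-σ / 2 - a / (2 * K * u)) ^ 2 / (-1 / u)) *
        jacobiTheta₂_term m ((-σ / 2 - a / (2 * K * u)) / (-1 / u)) (-1 / (-1 / u))) =
      Complex.exp (Real.pi * Complex.I * (2 * m + σ) * a / (2 * K)) *
        Complex.exp (Real.pi * Complex.I * (2 * m + σ) ^ 2 * w / (16 * K ^ 2 / c : ℝ)) := by
    intro m
    rw [jacobiTheta₂_term, ← Complex.exp_add, ← Complex.exp_add, ← Complex.exp_add]
    congr 1
    rw [hu]
    push_cast
    field_simp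
    ring
  have hsm : Summable fun m : ℤ =>
      Complex.exp (Real.pi * Complex.I * (2 * m + σ) * a / (2 * K)) *
        Complex.exp (Real.pi * Complex.I * (2 * m + σ) ^ 2 * w / (16 * K ^ 2 / c : ℝ)) := by
    simp_rw [← hexp]
    refine (((summable_jacobiTheta₂_term_iff _ _).mpr ?_).mul_left _).mul_left _
    rw [show (-1 / (-1 / u)) = u by field_simp]
    exact huim
  rw [latticeTheta_eq, hT, hz, jacobiTheta₂_functional_equation, hpre]
  rw [mul_assoc (_ ^ _), mul_left_comm, jacobiTheta₂, ← tsum_mul_left (a := Complex.exp (_ / _)),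
    ← tsum_mul_left, tsum_congr hexp, tsum_int_eq_sum_tsum hK hsm]
  congr 1
  refine Finset.sum_congr rfl fun j _ => ?_
  rw [latticeTheta, ← tsum_mul_left]
  refine tsum_congr fun n => ?_
  rw [neg_one_zpow_eq_exp, ← mul_assoc, ← Complex.exp_add, ← Complex.exp_add, ← Complex.exp_add]
  congr 1
  push_cast
  field_simp
  ring

/-- The hypothesis compares `((2Kn + a)² - a²) t / c` modulo 2: relative to the term `n = 0`, the
translation may change the phase only by passing from `σ` to `σ'`. -/
lemma latticeTheta_add {K : ℕ} {c : ℝ} (hc : c ≠ 0) (σ σ' a : ℤ) (t : ℤ) (τ : ℂ)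
    (h : ∀ n : ℤ, ∃ m : ℤ, ((4 * K ^ 2 * n ^ 2 + 4 * K * n * a) * t / c : ℝ) + σ * n =
      σ' * n + 2 * m) :
    latticeTheta K c σ a (τ + t) =
      Complex.exp (Real.pi * Complex.I * a ^ 2 * t / c) * latticeTheta K c σ' a τ := by
  rw [latticeTheta, latticeTheta, ← tsum_mul_left]
  refine tsum_congr fun n => ?_
  obtain ⟨m, hm⟩ := h n
  have hm' : ((4 * K ^ 2 * n ^ 2 + 4 * K * n * a) * t / c : ℂ) + σ * n = σ' * n + 2 * m := by
    exact_mod_cast hm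
  have hc0 : (c : ℂ) ≠ 0 := by exact_mod_cast hc
  rw [neg_one_zpow_eq_exp, neg_one_zpow_eq_exp, ← Complex.exp_add, ← Complex.exp_add,
    ← Complex.exp_add, Complex.exp_eq_exp_iff_exists_int]
  refine ⟨m, ?_⟩
  push_cast
  linear_combination (Real.pi * Complex.I) * hm'

lemma eta_neg_one_div {w : ℂ} (hw : 0 < w.im) :
    ModularForm.eta (-1 / w) = (-Complex.I * w) ^ (1 / 2 : ℂ) * ModularForm.eta w := by
  have h := ModularForm.eta_comp_eq_csqrt_I_inv (x := w) hw
  simp only [Function.comp_apply, Pi.smul_apply, Pi.mul_apply, smul_eq_mul] at h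
  have hw0 : w ≠ 0 := by rintro rfl; simp at hw
  have harg := Complex.arg_nonneg_iff.mpr hw.le
  -- As `arg (-i) = -π/2` and `arg w ∈ [0, π]`, the principal logarithms add without correction.
  have harg' : Complex.log (-Complex.I * w) = Complex.log (-Complex.I) + Complex.log w := by
    rw [Complex.log_mul_eq_add_log_iff (neg_ne_zero.mpr Complex.I_ne_zero) hw0,
      Complex.arg_neg_I]
    have := Complex.arg_le_pi w
    constructor <;> linarith [Real.pi_pos]
  rw [h, ← mul_assoc]
  congr 1
  rw [Complex.sqrt, Complex.sqrt, Complex.cpow_def_of_ne_zero Complex.I_ne_zero,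
    Complex.cpow_def_of_ne_zero hw0, Complex.cpow_def_of_ne_zero (by simp [hw0]), harg',
    Complex.log_I, Complex.log_neg_I, ← Complex.exp_neg, ← Complex.exp_add]
  congr 1
  ring

lemma cpow_half_mul_ofReal {z : ℂ} (hz : z ≠ 0) {r : ℝ} (hr : 0 < r) :
    (z * (r : ℂ)) ^ (1 / 2 : ℂ) = z ^ (1 / 2 : ℂ) * ((√r : ℝ) : ℂ) := by
  rw [Complex.cpow_def_of_ne_zero (mul_ne_zero hz (Complex.ofReal_ne_zero.mpr hr.ne')),
    Complex.cpow_def_of_ne_zero hz, Complex.log_mul_ofReal r hr z hz, add_mul, Complex.exp_add,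
    mul_comm, Real.sqrt_eq_rpow, Complex.ofReal_cpow hr.le,
    Complex.cpow_def_of_ne_zero (Complex.ofReal_ne_zero.mpr hr.ne'), Complex.ofReal_log hr.le]
  push_cast
  rfl

/-! ### Theta quotients and the folding of residues into cosines -/

/-- The quotient of a theta series by `η`. -/
def thetaQuot (K : ℕ) (c : ℝ) (σ a : ℤ) (τ : ℂ) : ℂ :=
  latticeTheta K c σ a τ / ModularForm.eta τ

lemma thetaQuot_neg_one_div {K : ℕ} (hK : 0 < K) {c : ℝ} (hc : 0 < c) (σ a : ℤ) {w : ℂ}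
    (hw : 0 < w.im) :
    thetaQuot K c σ a (-1 / w) = ((√(c / (4 * K ^ 2)) : ℝ) : ℂ) *
      ∑ j ∈ Finset.range K, Complex.exp (Real.pi * Complex.I * (2 * j + σ) * a / (2 * K)) *
        thetaQuot K (16 * K ^ 2 / c) a (2 * j + σ) w := by
  have hw0 : w ≠ 0 := by rintro rfl; simp at hw
  have hI : -Complex.I * w ≠ 0 := by simp [hw0]
  have hz : (-Complex.I * w) ^ (1 / 2 : ℂ) ≠ 0 := by
    rw [Complex.cpow_def_of_ne_zero hI]; exact Complex.exp_ne_zero _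
  simp only [thetaQuot]
  rw [latticeTheta_neg_one_div hK hc σ a hw, cpow_half_mul_ofReal hI (by positivity),
    eta_neg_one_div hw, mul_assoc, mul_div_mul_left _ _ hz, mul_div_assoc, Finset.sum_div]
  simp_rw [mul_div_assoc]

lemma eta_add_int (t : ℤ) (τ : ℂ) :
    ModularForm.eta (τ + t) =
      Complex.exp (Real.pi * Complex.I * t / 12) * ModularForm.eta τ := by
  have h1 : Function.Periodic.qParam 24 (τ + t) =
      Complex.exp (Real.pi * Complex.I * t / 12) * Function.Periodic.qParam 24 τ := by
    rw [Function.Periodic.qParam, Function.Periodic.qParam, ← Complex.exp_add]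
    congr 1; push_cast; ring
  have h2 : Function.Periodic.qParam 1 (τ + t) = Function.Periodic.qParam 1 τ := by
    rw [Function.Periodic.qParam, Function.Periodic.qParam, Complex.exp_eq_exp_iff_exists_int]
    refine ⟨t, ?_⟩
    push_cast; ring
  simp only [ModularForm.eta, ModularForm.eta_q, h1, h2, mul_assoc]

lemma thetaQuot_congr_char (K : ℕ) (c : ℝ) {σ σ' : ℤ} (h : Even (σ - σ')) (a : ℤ) (τ : ℂ) :
    thetaQuot K c σ a τ = thetaQuot K c σ' a τ := by
  rw [thetaQuot, latticeTheta_congr_char K c h, thetaQuot]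

lemma thetaQuot_sub (K : ℕ) (c : ℝ) (σ a : ℤ) (τ : ℂ) :
    thetaQuot K c σ (2 * K - a) τ = (-1) ^ σ * thetaQuot K c σ a τ := by
  rw [thetaQuot, latticeTheta_sub, thetaQuot, mul_div_assoc]

/-- The residue `K` is fixed by `b ↦ 2K - b`, which acts by the sign `-1` when the character is odd.
-/
lemma thetaQuot_self_of_odd (K : ℕ) (c : ℝ) {σ : ℤ} (h : Odd σ) (τ : ℂ) :
    thetaQuot K c σ K τ = 0 := by
  have := thetaQuot_sub K c σ K τ
  rw [h.neg_one_zpow, show (2 * K - K : ℤ) = K by ring] at this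
  linear_combination this / 2

lemma sum_range_eq_fold (h : ℕ → ℂ) (k : ℕ) :
    ∑ j ∈ Finset.range k, h j = ∑ j ∈ Finset.range (k / 2), (h j + h (k - 1 - j)) +
      if Odd k then h (k / 2) else 0 := by
  have key : ∀ m c : ℕ, ∑ j ∈ Finset.range m, h (c + j) =
      ∑ j ∈ Finset.range m, h (c + m - 1 - j) := by
    intro m c
    rw [← Finset.sum_range_reflect]
    refine Finset.sum_congr rfl fun j hj => ?_
    rw [Finset.mem_range] at hj
    congr 1
    omega
  obtain ⟨m, rfl | rfl⟩ := k.even_or_odd'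
  · rw [if_neg (by simp), add_zero, show 2 * m / 2 = m by omega, two_mul, Finset.sum_range_add,
      Finset.sum_add_distrib, key]
  · rw [if_pos (by simp), show (2 * m + 1) / 2 = m by omega, show 2 * m + 1 = m + 1 + m by omega,
      Finset.sum_range_add, Finset.sum_add_distrib, key, Finset.sum_range_succ]
    ring

/-- The sign `(-1)^a` from `thetaQuot_sub` turns the phase of `2K - b` into the complex conjugate of
the phase of `b`. -/
lemma exp_mul_thetaQuot_add {K : ℕ} (hK : 0 < K) (c : ℝ) (a b b' : ℤ) (hb : b + b' = 2 * K)
    (τ : ℂ) :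
    Complex.exp (Real.pi * Complex.I * b * a / (2 * K)) * thetaQuot K c a b τ +
      Complex.exp (Real.pi * Complex.I * b' * a / (2 * K)) * thetaQuot K c a b' τ =
      2 * (Complex.cos (b * a * Real.pi / (2 * K)) * thetaQuot K c a b τ) := by
  obtain rfl : b' = 2 * K - b := by omega
  have hK0 : (K : ℂ) ≠ 0 := by exact_mod_cast hK.ne'
  have h1 : Complex.exp (Real.pi * Complex.I * (2 * K - b : ℤ) * a / (2 * K)) * (-1) ^ a =
      Complex.exp (-(b * a * Real.pi / (2 * K)) * Complex.I) := by
    rw [neg_one_zpow_eq_exp_neg, ← Complex.exp_add]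
    congr 1
    push_cast
    field_simp
    ring
  rw [thetaQuot_sub, ← mul_assoc, h1, Complex.cos]
  rw [show Real.pi * Complex.I * b * a / (2 * K) = b * a * Real.pi / (2 * K) * Complex.I by ring]
  ring

lemma sum_exp_mul_thetaQuot_one {K : ℕ} (hK : 0 < K) (c : ℝ) (a : ℤ) (τ : ℂ) :
    ∑ j ∈ Finset.range K, Complex.exp (Real.pi * Complex.I * (2 * j + (1 : ℤ)) * a / (2 * K)) *
        thetaQuot K c a (2 * j + 1) τ =
      ∑ j ∈ Finset.range (K / 2), 2 * (Complex.cos ((2 * j + 1) * a * Real.pi / (2 * K)) *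
        thetaQuot K c a (2 * j + 1) τ) +
      if Odd K then Complex.exp (Real.pi * Complex.I * a / 2) * thetaQuot K c a K τ else 0 := by
  have hK0 : (K : ℂ) ≠ 0 := by exact_mod_cast hK.ne'
  rw [sum_range_eq_fold]
  congr 1
  · refine Finset.sum_congr rfl fun j hj => ?_
    rw [Finset.mem_range] at hj
    have := exp_mul_thetaQuot_add hK c a (2 * j + 1) (2 * (K - 1 - j : ℕ) + 1) (by omega) τ
    push_cast at this ⊢
    exact this
  · split_ifs with h
    · obtain ⟨m, rfl⟩ := h
      rw [show (2 * m + 1) / 2 = m by omega]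
      push_cast at hK0 ⊢
      congr 2
      field_simp
    · rfl

/-- For even residues the class `0` has no partner, whence the first column of `C_k`. The other
self-paired class, `K` for even `K`, vanishes since the character is odd. -/
lemma sum_exp_mul_thetaQuot_zero {K : ℕ} (hK : 0 < K) (c : ℝ) {a : ℤ} (ha : Odd a) (τ : ℂ) :
    ∑ j ∈ Finset.range K, Complex.exp (Real.pi * Complex.I * (2 * j + (0 : ℤ)) * a / (2 * K)) *
        thetaQuot K c a (2 * j + 0) τ =
      ∑ j ∈ Finset.range ((K - 1) / 2), 2 * (Complex.cos ((2 * (j + 1)) * a * Real.pi / (2 * K)) *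
        thetaQuot K c a (2 * (j + 1)) τ) + thetaQuot K c a 0 τ := by
  obtain ⟨k, rfl⟩ : ∃ k, K = k + 1 := ⟨K - 1, by omega⟩
  rw [Finset.sum_range_succ', sum_range_eq_fold, add_assoc]
  congr 1
  · refine Finset.sum_congr rfl fun j hj => ?_
    rw [Nat.add_sub_cancel, Finset.mem_range] at hj
    have := exp_mul_thetaQuot_add hK c a (2 * (j + 1)) (2 * ((k - 1 - j : ℕ) + 1)) (by omega) τ
    push_cast at this ⊢
    simp only [add_zero]
    exact this
  · have h2 : (if Odd k then Complex.exp (Real.pi * Complex.I * (2 * ((k / 2 + 1 : ℕ) : ℂ) +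
        (0 : ℤ)) * a / (2 * (k + 1 : ℕ))) *
          thetaQuot (k + 1) c a (2 * ((k / 2 + 1 : ℕ) : ℤ) + 0) τ else 0) = 0 := by
      split_ifs with h
      · have h3 := thetaQuot_self_of_odd (k + 1) c ha τ
        have : (2 * ((k / 2 + 1 : ℕ) : ℤ) + 0) = ((k + 1 : ℕ) : ℤ) := by
          obtain ⟨m, rfl⟩ := h; omega
        rw [this, h3, mul_zero]
      · rfl
    rw [h2]
    simp

/-! ### Transformation laws of the two vectors and their duals -/

/-- The dual vector of `X0`. -/
def dualX0 (k : ℕ) (τ : ℂ) : Fin ((k + 1) / 2) → ℂ :=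
  fun j => thetaQuot k (8 * k) 0 (2 * (j : ℕ) + 1) τ

/-- The dual vector of `X1`. -/
def dualX1 (k : ℕ) (τ : ℂ) : Fin (k / 2) → ℂ :=
  fun j => thetaQuot k (8 * k) 1 (2 * (j : ℕ) + 1) τ

lemma X0_apply {k : ℕ} (hk : 2 ≤ k) {τ : ℂ} (hτ : 0 < τ.im) (j : Fin ((k + 1) / 2)) :
    X0 k τ j = thetaQuot k (2 * k) 1 (2 * (j : ℕ)) τ := by
  rw [X0, component_eq hk (by omega) hτ, thetaQuot]
  push_cast
  rfl

lemma X1_apply {k : ℕ} (hk : 2 ≤ k) {τ : ℂ} (hτ : 0 < τ.im) (j : Fin (k / 2)) :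
    X1 k τ j = thetaQuot k (2 * k) 1 (2 * (j : ℕ) + 1) τ := by
  rw [X1, component_eq hk (by omega) hτ, thetaQuot]
  push_cast
  rfl

/-- The dual character `2i` is even, hence trivial, so for odd `k` the self-paired residue `k`
survives; its coefficient is not doubled, which accounts for the halved last column of `B_k`. -/
lemma X0_neg_one_div {k : ℕ} (hk : 2 ≤ k) {w : ℂ} (hw : 0 < w.im) :
    X0 k (-1 / w) = (((√(2 * k / (4 * k ^ 2)) : ℝ) * 2 : ℂ) • matB k).mulVec (dualX0 k w) := by
  have hk0 : 0 < k := by omega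
  have hkR : (0 : ℝ) < k := by exact_mod_cast hk0
  have hkC : (k : ℂ) ≠ 0 := by exact_mod_cast hk0.ne'
  ext i
  rw [X0_apply hk (im_neg_one_div_pos hw), thetaQuot_neg_one_div hk0 (by positivity) _ _ hw,
    sum_exp_mul_thetaQuot_one hk0, Matrix.smul_mulVec, Pi.smul_apply, smul_eq_mul,
    mul_assoc (Complex.ofReal (√_))]
  congr 1
  have hc : (16 * (k : ℝ) ^ 2 / (2 * k)) = 8 * k := by field_simp; norm_num
  have hσ : ∀ b, thetaQuot k (8 * k) (2 * (i : ℕ)) b w = thetaQuot k (8 * k) 0 b w := fun b =>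
    thetaQuot_congr_char _ _ (by simp) _ _
  have hsum : (matB k).mulVec (dualX0 k w) i = ∑ j ∈ Finset.range ((k + 1) / 2),
      (if Odd k ∧ j + 1 = (k + 1) / 2 then ((1 / 2 * Real.cos ((i : ℕ) * Real.pi) : ℝ) : ℂ)
        else ((Real.cos ((i : ℕ) * (2 * (j : ℕ) + 1) * Real.pi / k) : ℝ) : ℂ)) *
        thetaQuot k (8 * k) 0 (2 * (j : ℕ) + 1) w :=
    Fin.sum_univ_eq_sum_range (fun j : ℕ =>
      (if Odd k ∧ j + 1 = (k + 1) / 2 then ((1 / 2 * Real.cos ((i : ℕ) * Real.pi) : ℝ) : ℂ)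
        else ((Real.cos ((i : ℕ) * (2 * (j : ℕ) + 1) * Real.pi / k) : ℝ) : ℂ)) *
        thetaQuot k (8 * k) 0 (2 * (j : ℕ) + 1) w) ((k + 1) / 2)
  have hcos : ∀ j : ℕ, Complex.cos ((2 * j + 1) * (2 * (i : ℕ) : ℤ) * Real.pi / (2 * k)) =
      ((Real.cos ((i : ℕ) * (2 * (j : ℕ) + 1) * Real.pi / k) : ℝ) : ℂ) := by
    intro j
    push_cast
    congr 1
    field_simp
  rw [hsum, hc]
  simp_rw [hσ, hcos]
  rcases Nat.even_or_odd k with h | h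
  · have hr : Finset.range ((k + 1) / 2) = Finset.range (k / 2) := by
      congr 1; obtain ⟨m, hm⟩ := h; omega
    rw [if_neg (Nat.not_odd_iff_even.mpr h), add_zero, Finset.mul_sum, hr]
    refine Finset.sum_congr rfl fun j _ => ?_
    rw [if_neg (fun h' => Nat.not_odd_iff_even.mpr h h'.1)]
  · have hd : (k + 1) / 2 = k / 2 + 1 := by obtain ⟨m, hm⟩ := h; omega
    have hr : Finset.range ((k + 1) / 2) = Finset.range (k / 2 + 1) := by rw [hd]
    rw [if_pos h, hr, Finset.sum_range_succ, mul_add, Finset.mul_sum, if_pos ⟨h, hd.symm⟩]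
    congr 1
    · refine Finset.sum_congr rfl fun j hj => ?_
      rw [Finset.mem_range] at hj
      rw [if_neg (by omega)]
    · have e1 : Complex.exp (Real.pi * Complex.I * ((2 * (i : ℕ) : ℤ) : ℂ) / 2) =
          ((Real.cos ((i : ℕ) * Real.pi) : ℝ) : ℂ) := by
        rw [Real.cos_nat_mul_pi]
        push_cast
        rw [← Complex.exp_pi_mul_I, ← Complex.exp_nat_mul]
        congr 1; ring
      have e2 : (k : ℤ) = 2 * ((k / 2 : ℕ) : ℤ) + 1 := by obtain ⟨m, hm⟩ := h; omega
      rw [e1, e2]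
      push_cast
      ring

/-- Here the dual character is odd, so the self-paired residue drops out and no exceptional column
arises. -/
lemma X1_neg_one_div {k : ℕ} (hk : 2 ≤ k) {w : ℂ} (hw : 0 < w.im) :
    X1 k (-1 / w) = (((√(2 * k / (4 * k ^ 2)) : ℝ) * 2 : ℂ) • matA k).mulVec (dualX1 k w) := by
  have hk0 : 0 < k := by omega
  have hkR : (0 : ℝ) < k := by exact_mod_cast hk0
  have hkC : (k : ℂ) ≠ 0 := by exact_mod_cast hk0.ne'
  ext i
  rw [X1_apply hk (im_neg_one_div_pos hw), thetaQuot_neg_one_div hk0 (by positivity) _ _ hw,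
    sum_exp_mul_thetaQuot_one hk0, Matrix.smul_mulVec, Pi.smul_apply, smul_eq_mul,
    mul_assoc (Complex.ofReal (√_))]
  congr 1
  have hc : (16 * (k : ℝ) ^ 2 / (2 * k)) = 8 * k := by field_simp; norm_num
  have hσ : ∀ b, thetaQuot k (8 * k) (2 * (i : ℕ) + 1) b w = thetaQuot k (8 * k) 1 b w := fun b =>
    thetaQuot_congr_char _ _ (by simp) _ _
  have hodd : Odd (2 * ((i : ℕ) : ℤ) + 1) := by simp
  rw [hc, thetaQuot_self_of_odd _ _ hodd, mul_zero, ite_self, add_zero, Matrix.mulVec,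
    dotProduct, Finset.mul_sum, Finset.sum_range]
  refine Finset.sum_congr rfl fun j _ => ?_
  rw [hσ, dualX1, matA, Matrix.of_apply]
  push_cast
  congr 3
  ring

lemma dualX0_neg_one_div {k : ℕ} (hk : 2 ≤ k) {w : ℂ} (hw : 0 < w.im) :
    dualX0 k (-1 / w) = (((√(8 * k / (4 * k ^ 2)) : ℝ) * 2 : ℂ) • matC k).mulVec (X0 k w) := by
  have hk0 : 0 < k := by omega
  have hkR : (0 : ℝ) < k := by exact_mod_cast hk0
  have hkC : (k : ℂ) ≠ 0 := by exact_mod_cast hk0.ne'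
  ext i
  have hodd : Odd (2 * ((i : ℕ) : ℤ) + 1) := by simp
  have hc : (16 * (k : ℝ) ^ 2 / (8 * k)) = 2 * k := by field_simp; norm_num
  have hσ : ∀ b, thetaQuot k (2 * k) (2 * (i : ℕ) + 1) b w = thetaQuot k (2 * k) 1 b w := fun b =>
    thetaQuot_congr_char _ _ (by simp) _ _
  rw [dualX0, thetaQuot_neg_one_div hk0 (by positivity) _ _ hw,
    sum_exp_mul_thetaQuot_zero hk0 _ hodd, Matrix.smul_mulVec, Pi.smul_apply, smul_eq_mul,
    mul_assoc (Complex.ofReal (√_))]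
  congr 1
  have hsum : (matC k).mulVec (X0 k w) i = ∑ j ∈ Finset.range ((k + 1) / 2),
      (if j = 0 then 1 / 2
        else ((Real.cos ((2 * (i : ℕ) + 1) * j * Real.pi / k) : ℝ) : ℂ)) *
        thetaQuot k (2 * k) 1 (2 * (j : ℕ)) w := by
    rw [Matrix.mulVec, dotProduct, ← Fin.sum_univ_eq_sum_range (fun j : ℕ => (if j = 0 then 1 / 2
        else ((Real.cos ((2 * (i : ℕ) + 1) * j * Real.pi / k) : ℝ) : ℂ)) *
        thetaQuot k (2 * k) 1 (2 * (j : ℕ)) w)]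
    refine Finset.sum_congr rfl fun j _ => ?_
    rw [X0_apply hk hw]
    rfl
  have hr : Finset.range ((k + 1) / 2) = Finset.range ((k - 1) / 2 + 1) := by congr 1; omega
  rw [hsum, hc, hr, Finset.sum_range_succ', mul_add,
    Finset.mul_sum, if_pos rfl]
  simp_rw [hσ]
  congr 1
  · refine Finset.sum_congr rfl fun j _ => ?_
    rw [if_neg j.succ_ne_zero]
    push_cast
    congr 3
    field_simp
  · simp

lemma dualX1_neg_one_div {k : ℕ} (hk : 2 ≤ k) {w : ℂ} (hw : 0 < w.im) :
    dualX1 k (-1 / w) = (((√(8 * k / (4 * k ^ 2)) : ℝ) * 2 : ℂ) • matA k).mulVec (X1 k w) := by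
  have hk0 : 0 < k := by omega
  have hkR : (0 : ℝ) < k := by exact_mod_cast hk0
  have hkC : (k : ℂ) ≠ 0 := by exact_mod_cast hk0.ne'
  ext i
  have hodd : Odd (2 * ((i : ℕ) : ℤ) + 1) := by simp
  have hc : (16 * (k : ℝ) ^ 2 / (8 * k)) = 2 * k := by field_simp; norm_num
  have hσ : ∀ b, thetaQuot k (2 * k) (2 * (i : ℕ) + 1) b w = thetaQuot k (2 * k) 1 b w := fun b =>
    thetaQuot_congr_char _ _ (by simp) _ _
  rw [dualX1, thetaQuot_neg_one_div hk0 (by positivity) _ _ hw,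
    sum_exp_mul_thetaQuot_one hk0, Matrix.smul_mulVec, Pi.smul_apply, smul_eq_mul,
    mul_assoc (Complex.ofReal (√_))]
  congr 1
  rw [hc, thetaQuot_self_of_odd _ _ hodd, mul_zero, ite_self, add_zero, Matrix.mulVec,
    dotProduct, Finset.mul_sum, Finset.sum_range]
  refine Finset.sum_congr rfl fun j _ => ?_
  rw [hσ, X1_apply hk hw, matA, Matrix.of_apply]
  push_cast
  congr 3
  ring

lemma thetaQuot_add {K : ℕ} {c : ℝ} (hc : c ≠ 0) (σ σ' a : ℤ) (t : ℤ) (τ : ℂ)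
    (h : ∀ n : ℤ, ∃ m : ℤ, ((4 * K ^ 2 * n ^ 2 + 4 * K * n * a) * t / c : ℝ) + σ * n =
      σ' * n + 2 * m) :
    thetaQuot K c σ a (τ + t) =
      Complex.exp (Real.pi * Complex.I * a ^ 2 * t / c - Real.pi * Complex.I * t / 12) *
        thetaQuot K c σ' a τ := by
  rw [thetaQuot, latticeTheta_add hc σ σ' a t τ h, eta_add_int, Complex.exp_sub, thetaQuot]
  field_simp

lemma X_add_one_aux {k : ℕ} (hk : 2 ≤ k) (a : ℤ) (τ : ℂ) :
    thetaQuot k (2 * k) 1 a (τ + 1) = Complex.exp (-(1 / 12) * Real.pi * Complex.I) *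
      (Complex.exp (a ^ 2 * Real.pi * Complex.I / (2 * k)) * thetaQuot k (2 * k) 1 a τ) := by
  have hkR : (k : ℝ) ≠ 0 := by exact_mod_cast (by omega : k ≠ 0)
  have h := thetaQuot_add (K := k) (c := 2 * k) (by positivity) 1 1 a 1 τ fun n =>
    ⟨k * n ^ 2 + n * a, by push_cast; field_simp; ring⟩
  rw [Int.cast_one] at h
  rw [h, ← mul_assoc, ← Complex.exp_add]
  congr 2
  push_cast
  ring

/-- At scale `8k` a shift by `-4` changes the phases by `-2πi(k n² + n a)` relative to `n = 0`, so
the character survives; `η` supplies `e^{πi/3}`. -/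
lemma dualX_sub_four_aux {k : ℕ} (hk : 2 ≤ k) (σ a : ℤ) (τ : ℂ) :
    thetaQuot k (8 * k) σ a (τ - 4) = Complex.exp (Real.pi * Complex.I / 3) *
      (Complex.exp (-(a ^ 2 * Real.pi * Complex.I / (2 * k))) * thetaQuot k (8 * k) σ a τ) := by
  have hkR : (k : ℝ) ≠ 0 := by exact_mod_cast (by omega : k ≠ 0)
  have hkC : (k : ℂ) ≠ 0 := by exact_mod_cast (by omega : k ≠ 0)
  have h := thetaQuot_add (K := k) (c := 8 * k) (by positivity) σ σ a (-4) τ fun n =>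
    ⟨-(k * n ^ 2 + n * a), by push_cast; field_simp; ring⟩
  rw [sub_eq_add_neg, show (-4 : ℂ) = ((-4 : ℤ) : ℂ) by norm_num, h, ← mul_assoc,
    ← Complex.exp_add]
  congr 2
  push_cast
  field_simp
  ring

lemma X0_add_one {k : ℕ} (hk : 2 ≤ k) {τ : ℂ} (hτ : 0 < τ.im) :
    X0 k (τ + 1) = (Complex.exp (-(1 / 12) * Real.pi * Complex.I) • evenT k).mulVec (X0 k τ) := by
  ext i
  rw [X0_apply hk (by simpa using hτ), Matrix.smul_mulVec, Pi.smul_apply, evenT,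
    Matrix.mulVec_diagonal, X0_apply hk hτ, X_add_one_aux hk, smul_eq_mul]
  push_cast
  rfl

lemma X1_add_one {k : ℕ} (hk : 2 ≤ k) {τ : ℂ} (hτ : 0 < τ.im) :
    X1 k (τ + 1) = (Complex.exp (-(1 / 12) * Real.pi * Complex.I) • Lam k).mulVec (X1 k τ) := by
  ext i
  rw [X1_apply hk (by simpa using hτ), Matrix.smul_mulVec, Pi.smul_apply, Lam,
    Matrix.mulVec_diagonal, X1_apply hk hτ, X_add_one_aux hk, smul_eq_mul]
  push_cast
  rfl

lemma Lam_inv (k : ℕ) : (Lam k)⁻¹ = Matrix.diagonal fun j : Fin (k / 2) =>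
    Complex.exp (-((2 * (j : ℕ) + 1) ^ 2 * Real.pi * Complex.I / (2 * k))) := by
  refine Matrix.inv_eq_right_inv ?_
  rw [Lam, Matrix.diagonal_mul_diagonal, ← Matrix.diagonal_one]
  congr 1
  ext j
  rw [← Complex.exp_add, add_neg_cancel, Complex.exp_zero]

lemma dualX0_sub_four {k : ℕ} (hk : 2 ≤ k) (τ : ℂ) :
    dualX0 k (τ - 4) =
      (Complex.exp (Real.pi * Complex.I / 3) • LamTilde k).mulVec (dualX0 k τ) := by
  ext i
  rw [Matrix.smul_mulVec, Pi.smul_apply, LamTilde, Matrix.mulVec_diagonal, dualX0,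
    dualX_sub_four_aux hk, smul_eq_mul]
  push_cast
  rfl

lemma dualX1_sub_four {k : ℕ} (hk : 2 ≤ k) (τ : ℂ) :
    dualX1 k (τ - 4) =
      (Complex.exp (Real.pi * Complex.I / 3) • (Lam k)⁻¹).mulVec (dualX1 k τ) := by
  ext i
  rw [Matrix.smul_mulVec, Pi.smul_apply, Lam_inv, Matrix.mulVec_diagonal, dualX1,
    dualX_sub_four_aux hk, smul_eq_mul]
  push_cast
  rfl

lemma div_four_mul_add_one_eq {τ : ℂ} (hτ : 0 < τ.im) :
    τ / (4 * τ + 1) = -1 / (-1 / τ - 4) := by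
  have h0 : τ ≠ 0 := by rintro rfl; simp at hτ
  have h1 : 4 * τ + 1 ≠ 0 := by
    intro h
    have := congrArg Complex.im h
    simp at this
    exact hτ.ne' this
  have h2 : -1 - 4 * τ ≠ 0 := fun h => h1 (by linear_combination -h)
  have h3 : -1 / τ - 4 = (-1 - 4 * τ) / τ := by field_simp
  rw [h3, ← div_mul, div_mul_eq_mul_div, div_eq_div_iff h1 h2]
  ring

lemma sqrt_mul_sqrt_eq {k : ℕ} (hk : 2 ≤ k) :
    ((√(2 * k / (4 * k ^ 2)) : ℝ) * 2 : ℂ) * ((√(8 * k / (4 * k ^ 2)) : ℝ) * 2 : ℂ) = 4 / k := by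
  have hkR : (0 : ℝ) < k := by exact_mod_cast (by omega : 0 < k)
  have h : √(2 * k / (4 * k ^ 2)) * √(8 * k / (4 * k ^ 2)) = 1 / (k : ℝ) := by
    rw [← Real.sqrt_mul (by positivity), Real.sqrt_eq_iff_mul_self_eq_of_pos (by positivity)]
    field_simp
    norm_num
  have h' : ((√(2 * k / (4 * k ^ 2)) : ℝ) : ℂ) * ((√(8 * k / (4 * k ^ 2)) : ℝ) : ℂ) =
      1 / (k : ℂ) := by rw [← Complex.ofReal_mul, h]; push_cast; rfl
  linear_combination 4 * h'

lemma X0_div_four_mul_add_one {k : ℕ} (hk : 2 ≤ k) {τ : ℂ} (hτ : 0 < τ.im) :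
    X0 k (τ / (4 * τ + 1)) = ((4 / (k : ℂ) * Complex.exp (Real.pi * Complex.I / 3)) •
      (matB k * LamTilde k * matC k)).mulVec (X0 k τ) := by
  have hv := im_neg_one_div_pos hτ
  rw [div_four_mul_add_one_eq hτ, X0_neg_one_div hk (by simpa using hv), dualX0_sub_four hk,
    dualX0_neg_one_div hk hτ, ← sqrt_mul_sqrt_eq hk, Matrix.mulVec_mulVec, Matrix.mulVec_mulVec]
  congr 1
  simp only [Matrix.smul_mul, Matrix.mul_smul, smul_smul]
  congr 1
  ring

lemma X1_div_four_mul_add_one {k : ℕ} (hk : 2 ≤ k) {τ : ℂ} (hτ : 0 < τ.im) :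
    X1 k (τ / (4 * τ + 1)) = ((4 / (k : ℂ) * Complex.exp (Real.pi * Complex.I / 3)) •
      (matA k * (Lam k)⁻¹ * matA k)).mulVec (X1 k τ) := by
  have hv := im_neg_one_div_pos hτ
  rw [div_four_mul_add_one_eq hτ, X1_neg_one_div hk (by simpa using hv), dualX1_sub_four hk,
    dualX1_neg_one_div hk hτ, ← sqrt_mul_sqrt_eq hk, Matrix.mulVec_mulVec, Matrix.mulVec_mulVec]
  congr 1
  simp only [Matrix.smul_mul, Matrix.mul_smul, smul_smul]
  congr 1
  ring

/-! ### Generators of `Γ_0(4)` -/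

/-- The lower unipotent matrix `[[1, 0], [4, 1]]`. -/
def lowerFour : SL(2, ℤ) := ModularGroup.S * ModularGroup.T ^ (-4 : ℤ) * ModularGroup.S⁻¹

lemma coe_S_mul_T_zpow_mul_S_inv (n : ℤ) :
    ((ModularGroup.S * ModularGroup.T ^ n * ModularGroup.S⁻¹ : SL(2, ℤ)) :
      Matrix (Fin 2) (Fin 2) ℤ) = !![1, 0; -n, 1] := by
  rw [Matrix.SpecialLinearGroup.coe_mul, Matrix.SpecialLinearGroup.coe_mul,
    ModularGroup.coe_T_zpow, Matrix.SpecialLinearGroup.coe_inv, ModularGroup.coe_S,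
    Matrix.adjugate_fin_two]
  simp

lemma coe_lowerFour : (lowerFour : Matrix (Fin 2) (Fin 2) ℤ) = !![1, 0; 4, 1] := by
  rw [lowerFour, coe_S_mul_T_zpow_mul_S_inv]
  simp

lemma coe_lowerFour_zpow (m : ℤ) :
    ((lowerFour ^ m : SL(2, ℤ)) : Matrix (Fin 2) (Fin 2) ℤ) = !![1, 0; 4 * m, 1] := by
  rw [lowerFour, conj_zpow, ← zpow_mul, coe_S_mul_T_zpow_mul_S_inv]
  simp

lemma exists_natAbs_add_mul_le (a : ℤ) {m : ℤ} (hm : m ≠ 0) :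
    ∃ n : ℤ, 2 * (a + n * m).natAbs ≤ m.natAbs := by
  have h1 := Int.bmod_lt (x := a) (m := m.natAbs) (by omega)
  have h2 := Int.le_bmod (x := a) (m := m.natAbs) (by omega)
  have h3 := Int.bmod_add_bdiv a m.natAbs
  obtain ⟨e, he⟩ : m ∣ a - a.bmod m.natAbs :=
    (Int.natAbs_dvd).mp ⟨a.bdiv m.natAbs, by linear_combination -h3⟩
  refine ⟨-e, ?_⟩
  rw [show a + -e * m = a.bmod m.natAbs by linear_combination he]
  omega

/-- Descent on `|γ 1 0|`: a power of `T` brings the upper left entry `a` to `2|a| < |γ 1 0|`, then a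
power of `lowerFour` reduces the lower left entry modulo `4a` to absolute value at most `2|a|`. -/
lemma Gamma0_four_le {H : Subgroup SL(2, ℤ)} (hT : ModularGroup.T ∈ H) (hU : lowerFour ∈ H)
    (hneg : (-1 : SL(2, ℤ)) ∈ H) : CongruenceSubgroup.Gamma0 4 ≤ H := by
  have main : ∀ n : ℕ, ∀ γ : SL(2, ℤ), (4 : ℤ) ∣ γ 1 0 → (γ 1 0).natAbs = n → γ ∈ H := by
    intro n
    induction n using Nat.strong_induction_on with
    | _ n ih =>
      intro γ h4 hn
      have hdet : γ 0 0 * γ 1 1 - γ 0 1 * γ 1 0 = 1 := by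
        rw [← Matrix.det_fin_two]; exact γ.det_coe
      rcases eq_or_ne (γ 1 0) 0 with h0 | h0
      · rw [h0, mul_zero, sub_zero] at hdet
        rcases Int.eq_one_or_neg_one_of_mul_eq_one' hdet with ⟨h1, h2⟩ | ⟨h1, h2⟩
        · have : γ = ModularGroup.T ^ (γ 0 1) := by
            ext i j
            rw [ModularGroup.coe_T_zpow]
            fin_cases i <;> fin_cases j <;> simp [h0, h1, h2]
          rw [this]
          exact H.zpow_mem hT _
        · have : γ = -1 * ModularGroup.T ^ (-γ 0 1) := by
            ext i j
            rw [neg_one_mul, Matrix.SpecialLinearGroup.coe_neg, ModularGroup.coe_T_zpow]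
            fin_cases i <;> fin_cases j <;> simp [h0, h1, h2]
          rw [this]
          exact H.mul_mem hneg (H.zpow_mem hT _)
      · obtain ⟨e, he⟩ := exists_natAbs_add_mul_le (γ 0 0) h0
        have hodd : ¬ (2 : ℤ) ∣ γ 0 0 + e * γ 1 0 := by
          intro h2
          have h2' : (2 : ℤ) ∣ γ 1 0 := (by norm_num : (2 : ℤ) ∣ 4).trans h4
          have h3 : (2 : ℤ) ∣ γ 0 0 := (Int.dvd_add_left (h2'.mul_left e)).mp h2
          have h5 : (2 : ℤ) ∣ 1 := by
            rw [← hdet]; exact dvd_sub (h3.mul_right _) (h2'.mul_left _)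
          omega
        set a := γ 0 0 + e * γ 1 0 with ha
        have ha0 : a ≠ 0 := by rintro h; exact hodd (by simp [h])
        -- Equality is impossible: `a` is odd while 4 divides `γ 1 0`.
        have hlt : 2 * a.natAbs < (γ 1 0).natAbs := by
          refine lt_of_le_of_ne he fun h => ?_
          omega
        obtain ⟨f, hf⟩ := exists_natAbs_add_mul_le (γ 1 0) (show 4 * a ≠ 0 by omega)
        have hprod : (lowerFour ^ f * (ModularGroup.T ^ e * γ)) 1 0 = γ 1 0 + f * (4 * a) := by
          rw [Matrix.SpecialLinearGroup.coe_mul, Matrix.SpecialLinearGroup.coe_mul,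
            coe_lowerFour_zpow, ModularGroup.coe_T_zpow]
          simp only [Matrix.mul_apply, Fin.sum_univ_two, Matrix.of_apply, Matrix.cons_val',
            Matrix.cons_val_zero, Matrix.cons_val_one, Matrix.cons_val_fin_one, ha]
          ring
        have hmem := ih _ (by rw [hprod]; omega) (lowerFour ^ f * (ModularGroup.T ^ e * γ))
          (by rw [hprod]; exact dvd_add h4 ((Dvd.intro _ rfl).mul_left f)) rfl
        rwa [H.mul_mem_cancel_left (H.zpow_mem hU _),
          H.mul_mem_cancel_left (H.zpow_mem hT _)] at hmem
  intro γ hγ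
  rw [CongruenceSubgroup.Gamma0_mem, ZMod.intCast_zmod_eq_zero_iff_dvd] at hγ
  exact main _ γ (by exact_mod_cast hγ) rfl

/-! ### From linearly independent components to a representation -/

section Representation

variable {ι : Type*} [Fintype ι]

lemma mulVec_eq_of_linearIndependent {F : UpperHalfPlane → ι → ℂ}
    (hF : ∀ v : ι → ℂ, (∀ τ, v ⬝ᵥ F τ = 0) → v = 0) {M N : Matrix ι ι ℂ}
    (h : ∀ τ, M.mulVec (F τ) = N.mulVec (F τ)) : M = N := by
  rw [← sub_eq_zero]
  refine Matrix.ext fun i j => congrFun (hF ((M - N) i) fun τ => ?_) j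
  have := congrFun (h τ) i
  rw [← sub_eq_zero] at this
  rw [← this]
  exact sub_dotProduct _ _ _

variable [DecidableEq ι]

/-- The elements of `SL(2, ℤ)` under which `F` transforms by a constant matrix. -/
def transformSubgroup (F : UpperHalfPlane → ι → ℂ)
    (hF : ∀ v : ι → ℂ, (∀ τ, v ⬝ᵥ F τ = 0) → v = 0) : Subgroup SL(2, ℤ) where
  carrier := {γ | ∃ M : Matrix ι ι ℂ, ∀ τ : UpperHalfPlane, F (γ • τ) = M.mulVec (F τ)}
  one_mem' := ⟨1, fun τ => by simp⟩
  mul_mem' := by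
    rintro γ δ ⟨M, hM⟩ ⟨N, hN⟩
    exact ⟨M * N, fun τ => by rw [mul_smul, hM, hN, Matrix.mulVec_mulVec]⟩
  inv_mem' := by
    rintro γ ⟨M, hM⟩
    -- A left null vector of `M` would be a linear relation among the components at `γτ`, hence at
    -- every point.
    have hdet : M.det ≠ 0 := by
      intro h
      obtain ⟨v, hv, hvM⟩ := Matrix.exists_vecMul_eq_zero_iff.mpr h
      refine hv (hF v fun τ => ?_)
      rw [← smul_inv_smul γ τ, hM, Matrix.dotProduct_mulVec, hvM, zero_dotProduct]
    refine ⟨M⁻¹, fun τ => ?_⟩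
    have h := hM (γ⁻¹ • τ)
    rw [smul_inv_smul] at h
    rw [h, Matrix.mulVec_mulVec, Matrix.nonsing_inv_mul _ (isUnit_iff_ne_zero.mpr hdet),
      Matrix.one_mulVec]

lemma exists_representation {F : UpperHalfPlane → ι → ℂ}
    (hF : ∀ v : ι → ℂ, (∀ τ, v ⬝ᵥ F τ = 0) → v = 0) {Γ : Subgroup SL(2, ℤ)}
    (h : Γ ≤ transformSubgroup F hF) :
    ∃ ρ : Γ →* GL ι ℂ, ∀ (γ : Γ) (τ : UpperHalfPlane),
      F ((γ : SL(2, ℤ)) • τ) = (ρ γ : Matrix ι ι ℂ).mulVec (F τ) := by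
  choose M hM using fun γ : Γ => h γ.2
  let φ : Γ →* Matrix ι ι ℂ :=
    { toFun := M
      map_one' := mulVec_eq_of_linearIndependent hF fun τ => by
        rw [← hM, Matrix.one_mulVec, Subgroup.coe_one, one_smul]
      map_mul' := fun γ δ => mulVec_eq_of_linearIndependent hF fun τ => by
        rw [← hM, ← Matrix.mulVec_mulVec, ← hM, ← hM, Subgroup.coe_mul, mul_smul] }
  exact ⟨φ.toHomUnits, fun γ τ => hM γ τ⟩

lemma Gamma0_four_le_transformSubgroup {F : UpperHalfPlane → ι → ℂ}
    (hF : ∀ v : ι → ℂ, (∀ τ, v ⬝ᵥ F τ = 0) → v = 0) {G : ℂ → ι → ℂ} (hG : ∀ τ, F τ = G τ)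
    {M N : Matrix ι ι ℂ} (hM : ∀ τ : ℂ, 0 < τ.im → G (τ + 1) = M.mulVec (G τ))
    (hN : ∀ τ : ℂ, 0 < τ.im → G (τ / (4 * τ + 1)) = N.mulVec (G τ)) :
    CongruenceSubgroup.Gamma0 4 ≤ transformSubgroup F hF := by
  refine Gamma0_four_le ⟨M, fun τ => ?_⟩ ⟨N, fun τ => ?_⟩ ⟨1, fun τ => ?_⟩
  · rw [hG, hG, ← hM _ τ.im_pos, UpperHalfPlane.modular_T_smul, UpperHalfPlane.coe_vadd]
    congr 1
    push_cast
    ring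
  · rw [hG, hG, ← hN _ τ.im_pos, UpperHalfPlane.coe_specialLinearGroup_apply]
    simp [coe_lowerFour]
  · rw [ModularGroup.SL_neg_smul, one_smul, Matrix.one_mulVec]

end Representation

/-! ### Linear independence of the components -/

lemma latticeTheta_mul_exp {k : ℕ} (hk : 0 < k) (s : ℕ) (y : ℝ) :
    latticeTheta k (2 * k) 1 s (Complex.I * y) * Complex.exp (Real.pi * s ^ 2 * y / (2 * k)) =
      jacobiTheta₂ (-1 / 2 + s * (Complex.I * y)) (2 * k * (Complex.I * y)) := by
  have hkC : (k : ℂ) ≠ 0 := by exact_mod_cast hk.ne'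
  rw [latticeTheta_eq, mul_right_comm, ← Complex.exp_add]
  have h : Real.pi * Complex.I * ((s : ℤ) : ℂ) ^ 2 * (Complex.I * y) / ((2 * k : ℝ) : ℂ) +
      Real.pi * s ^ 2 * y / (2 * k) = 0 := by
    push_cast
    field_simp
    rw [Complex.I_sq]
    ring
  rw [h, Complex.exp_zero, one_mul]
  congr 1
  · push_cast
    field_simp
  · push_cast
    field_simp
    ring

lemma tendsto_jacobiTheta₂_one {k s : ℕ} (hs : s < k) :
    Tendsto (fun y : ℝ =>
      jacobiTheta₂ (-1 / 2 + s * (Complex.I * y)) (2 * k * (Complex.I * y))) atTop (𝓝 1) := by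
  have hk : 0 < k := by omega
  have hnorm : ∀ (n : ℤ) (y : ℝ),
      ‖jacobiTheta₂_term n (-1 / 2 + s * (Complex.I * y)) (2 * k * (Complex.I * y))‖ =
        Real.exp (-(2 * Real.pi * (k * n ^ 2 + n * s : ℤ)) * y) := by
    intro n y
    rw [norm_jacobiTheta₂_term]
    congr 1
    have h1 : (2 * k * (Complex.I * y) : ℂ).im = 2 * k * y := by simp
    have h2 : (-1 / 2 + s * (Complex.I * y) : ℂ).im = s * y := by
      simp
    rw [h1, h2]
    push_cast
    ring
  -- As `|n| ≥ 1` and `s < k`, one has `k n² + n s ≥ |n| (k - s) > 0`: the term `n = 0` strictly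
  -- dominates at `i∞`.
  have hpos : ∀ n : ℤ, n ≠ 0 → 0 < k * n ^ 2 + n * s := by
    intro n hn
    have h1 : 0 < |n| := abs_pos.mpr hn
    have h2 : (s : ℤ) < k := by exact_mod_cast hs
    have h3 : -(|n| * s) ≤ n * s := by
      rw [← neg_mul]; exact mul_le_mul_of_nonneg_right (neg_abs_le n) (by positivity)
    have h4 : |n| * |n| ≥ |n| := le_mul_of_one_le_left h1.le h1
    have h5 := mul_le_mul_of_nonneg_left h4 (show (0 : ℤ) ≤ k by positivity)
    have h6 := mul_pos h1 (sub_pos.mpr h2)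
    rw [← sq_abs]
    nlinarith
  have hnn : ∀ n : ℤ, 0 ≤ k * n ^ 2 + n * s := by
    intro n
    rcases eq_or_ne n 0 with rfl | hn
    · simp
    · exact (hpos n hn).le
  have hsum : Summable fun n : ℤ =>
      ‖jacobiTheta₂_term n (-1 / 2 + s * (Complex.I * (1 : ℝ)))
        (2 * k * (Complex.I * (1 : ℝ)))‖ := by
    refine ((summable_jacobiTheta₂_term_iff _ _).mpr ?_).norm
    simp [hk]
  have hlim := tendsto_tsum_of_dominated_convergence (𝓕 := atTop)
    (f := fun (y : ℝ) (n : ℤ) =>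
      jacobiTheta₂_term n (-1 / 2 + s * (Complex.I * y)) (2 * k * (Complex.I * y)))
    (g := fun n => if n = 0 then 1 else 0) hsum ?_ ?_
  · rw [tsum_ite_eq] at hlim
    exact hlim
  · intro n
    split_ifs with hn
    · subst hn
      simp [jacobiTheta₂_term]
    · rw [tendsto_zero_iff_norm_tendsto_zero]
      simp_rw [hnorm]
      refine Real.tendsto_exp_atBot.comp (tendsto_id.const_mul_atTop_of_neg ?_)
      have : (0 : ℝ) < (k * n ^ 2 + n * s : ℤ) := by exact_mod_cast hpos n hn
      have := Real.pi_pos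
      rw [neg_lt_zero]
      positivity
  · filter_upwards [eventually_ge_atTop 1] with y hy n
    rw [hnorm, hnorm, Real.exp_le_exp]
    have h1 : (0 : ℝ) ≤ (k * n ^ 2 + n * s : ℤ) := by exact_mod_cast hnn n
    have h2 : 0 ≤ 2 * Real.pi * (k * n ^ 2 + n * s : ℤ) := by positivity
    nlinarith

lemma tendsto_latticeTheta_mul_exp {k s s' : ℕ} (hs' : s' < k) (h : s ≤ s') :
    Tendsto (fun y : ℝ => latticeTheta k (2 * k) 1 s' (Complex.I * y) *
      Complex.exp (Real.pi * s ^ 2 * y / (2 * k))) atTop (𝓝 (if s' = s then 1 else 0)) := by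
  have hk : 0 < k := by omega
  have hkR : (0 : ℝ) < k := by exact_mod_cast hk
  have h1 := tendsto_jacobiTheta₂_one hs'
  simp_rw [← latticeTheta_mul_exp hk s'] at h1
  split_ifs with he
  · subst he
    exact h1
  · have h2 : Tendsto (fun y : ℝ =>
        Complex.exp (((-(Real.pi * ((s' : ℝ) ^ 2 - s ^ 2) / (2 * k)) * y : ℝ) : ℂ)))
        atTop (𝓝 0) := by
      rw [tendsto_zero_iff_norm_tendsto_zero]
      simp_rw [Complex.norm_exp_ofReal]
      refine Real.tendsto_exp_atBot.comp (tendsto_id.const_mul_atTop_of_neg ?_)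
      have h3 : (s : ℝ) < s' := by exact_mod_cast lt_of_le_of_ne h (Ne.symm he)
      have h4 : (0 : ℝ) < (s' : ℝ) ^ 2 - s ^ 2 := by
        have : (0 : ℝ) ≤ s := by positivity
        nlinarith
      have := Real.pi_pos
      rw [neg_lt_zero]
      positivity
    have h3 := h1.mul h2
    rw [mul_zero] at h3
    refine h3.congr fun y => ?_
    rw [mul_assoc, ← Complex.exp_add]
    congr 2
    push_cast
    ring

/-- Along `τ = iy` the theta series of residue `s` behaves like `exp(-π s² y / (2k))`. The
coefficients vanish in order of increasing `s`: rescale by the slowest remaining decay and let `y →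
∞`. -/
lemma eq_zero_of_sum_thetaQuot_eq_zero {k d : ℕ} (s : Fin d → ℕ) (hs : ∀ i, s i < k)
    (hmono : StrictMono s) {v : Fin d → ℂ}
    (h : ∀ τ : UpperHalfPlane, ∑ i, v i * thetaQuot k (2 * k) 1 (s i) τ = 0) : v = 0 := by
  have hlat : ∀ y : ℝ, 0 < y →
      ∑ i, v i * latticeTheta k (2 * k) 1 (s i) (Complex.I * y) = 0 := by
    intro y hy
    have hy' : 0 < (Complex.I * y : ℂ).im := by simpa using hy
    have h1 := h ⟨Complex.I * y, hy'⟩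
    have h2 := ModularForm.eta_ne_zero (z := Complex.I * y) hy'
    simp only [thetaQuot, ← mul_div_assoc, ← Finset.sum_div] at h1
    exact (div_eq_zero_iff.mp h1).resolve_right h2
  have key : ∀ n : ℕ, ∀ j : Fin d, (j : ℕ) = n → v j = 0 := by
    intro n
    induction n using Nat.strong_induction_on with
    | _ n ih =>
      intro j hj
      have hlim : Tendsto (fun y : ℝ => ∑ i, v i * (latticeTheta k (2 * k) 1 (s i) (Complex.I * y) *
          Complex.exp (Real.pi * s j ^ 2 * y / (2 * k)))) atTop
          (𝓝 (∑ i, v i * if i = j then 1 else 0)) := by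
        refine tendsto_finsetSum _ fun i _ => ?_
        rcases lt_or_ge i j with hij | hij
        · rw [ih i (by omega) i rfl]
          simp
        · refine Tendsto.const_mul _ ?_
          have := tendsto_latticeTheta_mul_exp (hs i) (hmono.monotone hij)
          simpa only [hmono.injective.eq_iff] using this
      have hzero : Tendsto (fun y : ℝ => ∑ i, v i *
          (latticeTheta k (2 * k) 1 (s i) (Complex.I * y) *
          Complex.exp (Real.pi * s j ^ 2 * y / (2 * k)))) atTop (𝓝 0) := by
        refine tendsto_const_nhds.congr' ?_
        filter_upwards [eventually_gt_atTop 0] with y hy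
        simp_rw [← mul_assoc]
        rw [← Finset.sum_mul, hlat y hy, zero_mul]
      simpa using tendsto_nhds_unique hlim hzero
  ext j
  exact key j j rfl

/-! ### Holomorphy and behaviour at the cusps -/

lemma differentiableAt_thetaQuot {K : ℕ} (hK : 0 < K) {c : ℝ} (hc : 0 < c) (σ a : ℤ) {τ : ℂ}
    (hτ : 0 < τ.im) : DifferentiableAt ℂ (thetaQuot K c σ a) τ := by
  have h1 : DifferentiableAt ℂ (latticeTheta K c σ a) τ := by
    rw [funext (latticeTheta_eq K c σ a)]
    refine DifferentiableAt.mul (by fun_prop) ?_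
    have h2 := (hasFDerivAt_jacobiTheta₂ (-σ / 2 + 2 * K * a * τ / c)
      (im_mul_div_pos hK hc hτ)).differentiableAt
    have h3 : DifferentiableAt ℂ
        (fun τ : ℂ => ((-σ / 2 + 2 * K * a * τ / c : ℂ), (4 * K ^ 2 * τ / c : ℂ))) τ := by
      fun_prop
    exact h2.comp τ h3
  exact h1.div (ModularForm.differentiableAt_eta_of_mem_upperHalfPlaneSet hτ)
    (ModularForm.eta_ne_zero hτ)

lemma mdifferentiable_thetaQuot {K : ℕ} (hK : 0 < K) {c : ℝ} (hc : 0 < c) (σ a : ℤ) :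
    MDifferentiable 𝓘(ℂ) 𝓘(ℂ) fun τ : UpperHalfPlane => thetaQuot K c σ a τ := by
  rw [UpperHalfPlane.mdifferentiable_iff]
  intro z hz
  refine ((differentiableAt_thetaQuot hK hc σ a hz).differentiableWithinAt).congr
    (fun w hw => ?_) ?_
  · simp [UpperHalfPlane.ofComplex_apply_of_im_pos hw]
  · simp [UpperHalfPlane.ofComplex_apply_of_im_pos hz]

/-- The space of functions on the upper half plane spanned by the quotients by `η` of the theta
series `∑_n (-1)^(σ n) q^((4 k n + a)² / (16 k))`. -/
def thetaSpan (k : ℕ) : Submodule ℂ (UpperHalfPlane → ℂ) :=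
  Submodule.span ℂ (Set.range fun p : ℤ × ℤ => fun τ : UpperHalfPlane =>
    thetaQuot (2 * k) (8 * k) p.1 p.2 τ)

lemma thetaQuot_mem_thetaSpan (k : ℕ) (σ a : ℤ) :
    (fun τ : UpperHalfPlane => thetaQuot (2 * k) (8 * k) σ a τ) ∈ thetaSpan k :=
  Submodule.subset_span ⟨(σ, a), rfl⟩

/-- Places the components in `thetaSpan`: doubling the residue and the period multiplies the squares
by 4, as does passing from scale `2k` to `8k`. -/
lemma thetaQuot_two_mul {k : ℕ} (hk : 0 < k) (s : ℤ) (τ : ℂ) :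
    thetaQuot (2 * k) (8 * k) 1 (2 * s) τ = thetaQuot k (2 * k) 1 s τ := by
  have hkC : (k : ℂ) ≠ 0 := by exact_mod_cast hk.ne'
  rw [thetaQuot, thetaQuot, latticeTheta, latticeTheta]
  congr 1
  refine tsum_congr fun n => ?_
  congr 2
  push_cast
  field_simp
  ring

/-- The elements of `SL(2, ℤ)` that preserve a space of functions on the upper half plane. -/
def stableSubgroup (V : Submodule ℂ (UpperHalfPlane → ℂ)) : Subgroup SL(2, ℤ) where
  carrier := {γ | ∀ f ∈ V, (fun τ => f (γ • τ)) ∈ V ∧ (fun τ => f (γ⁻¹ • τ)) ∈ V}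
  one_mem' := fun f hf => by simpa using hf
  mul_mem' := by
    intro γ δ hγ hδ f hf
    constructor
    · simp_rw [mul_smul]
      exact (hδ _ (hγ f hf).1).1
    · simp_rw [mul_inv_rev, mul_smul]
      exact (hγ _ (hδ f hf).2).2
  inv_mem' := by
    intro γ hγ f hf
    rw [inv_inv]
    exact (hγ f hf).symm

lemma comp_mem_thetaSpan {k : ℕ} {γ : SL(2, ℤ)}
    (h : ∀ σ a : ℤ,
      (fun τ : UpperHalfPlane => thetaQuot (2 * k) (8 * k) σ a ↑(γ • τ)) ∈ thetaSpan k)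
    {f : UpperHalfPlane → ℂ} (hf : f ∈ thetaSpan k) : (fun τ => f (γ • τ)) ∈ thetaSpan k := by
  have : thetaSpan k ≤ (thetaSpan k).comap (LinearMap.funLeft ℂ ℂ fun τ => γ • τ) := by
    refine Submodule.span_le.mpr ?_
    rintro _ ⟨p, rfl⟩
    exact h p.1 p.2
  exact this hf

/-- With half-period `K = 2k` the scale `8k` is self-dual: `16 K² / (8k) = 8k`. -/
lemma thetaQuot_S_mem {k : ℕ} (hk : 0 < k) (σ a : ℤ) :
    (fun τ : UpperHalfPlane => thetaQuot (2 * k) (8 * k) σ a ↑(ModularGroup.S • τ)) ∈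
      thetaSpan k := by
  have hkR : (k : ℝ) ≠ 0 := by exact_mod_cast hk.ne'
  have h : ∀ τ : UpperHalfPlane, thetaQuot (2 * k) (8 * k) σ a ↑(ModularGroup.S • τ) =
      ((√(8 * k / (4 * (2 * k : ℕ) ^ 2)) : ℝ) : ℂ) * ∑ j ∈ Finset.range (2 * k),
        Complex.exp (Real.pi * Complex.I * (2 * j + σ) * a / (2 * (2 * k : ℕ))) *
          thetaQuot (2 * k) (16 * (2 * k : ℕ) ^ 2 / (8 * k)) a (2 * j + σ) τ :=
    fun τ => by
      rw [UpperHalfPlane.modular_S_smul, UpperHalfPlane.coe_mk,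
        show (-(τ : ℂ))⁻¹ = -1 / τ by rw [inv_neg, neg_div, one_div]]
      exact thetaQuot_neg_one_div (by omega) (by positivity) σ a τ.im_pos
  have hc : (16 * ((2 * k : ℕ) : ℝ) ^ 2 / (8 * k)) = 8 * k := by
    push_cast
    field_simp
    norm_num
  rw [hc] at h
  simp_rw [h]
  refine (thetaSpan k).smul_mem _ ?_
  have hsum : (fun τ : UpperHalfPlane => ∑ j ∈ Finset.range (2 * k),
      Complex.exp (Real.pi * Complex.I * (2 * j + σ) * a / (2 * (2 * k : ℕ))) *
        thetaQuot (2 * k) (8 * k) a (2 * j + σ) τ) = ∑ j ∈ Finset.range (2 * k),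
      Complex.exp (Real.pi * Complex.I * (2 * j + σ) * a / (2 * (2 * k : ℕ))) •
        fun τ : UpperHalfPlane => thetaQuot (2 * k) (8 * k) a (2 * j + σ) τ := by
    ext τ
    simp
  rw [hsum]
  exact Submodule.sum_mem _ fun j _ =>
    Submodule.smul_mem _ _ (thetaQuot_mem_thetaSpan k a (2 * j + σ))

/-- At this scale the phase relative to `n = 0` changes by `πi(2k n² t + n a t)`, so translation by
`t` just moves the character to `σ + a t`. -/
lemma thetaQuot_T_zpow_mem {k : ℕ} (hk : 0 < k) (t σ a : ℤ) :
    (fun τ : UpperHalfPlane => thetaQuot (2 * k) (8 * k) σ a ↑(ModularGroup.T ^ t • τ)) ∈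
      thetaSpan k := by
  have hkR : (k : ℝ) ≠ 0 := by exact_mod_cast hk.ne'
  have h : ∀ τ : UpperHalfPlane, thetaQuot (2 * k) (8 * k) σ a ↑(ModularGroup.T ^ t • τ) =
      Complex.exp (Real.pi * Complex.I * a ^ 2 * t / ((8 * k : ℝ) : ℂ) -
        Real.pi * Complex.I * t / 12) * thetaQuot (2 * k) (8 * k) (σ + a * t) a τ :=
    fun τ => by
      rw [UpperHalfPlane.modular_T_zpow_smul, UpperHalfPlane.coe_vadd, add_comm,
        Complex.ofReal_intCast]
      exact thetaQuot_add (by positivity) σ (σ + a * t) a t τ fun n =>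
        ⟨k * n ^ 2 * t, by push_cast; field_simp; ring⟩
  simp_rw [h]
  exact (thetaSpan k).smul_mem _ (thetaQuot_mem_thetaSpan k _ _)

lemma stableSubgroup_thetaSpan {k : ℕ} (hk : 0 < k) : stableSubgroup (thetaSpan k) = ⊤ := by
  rw [eq_top_iff, ← SpecialLinearGroup.SL2Z_generators, Subgroup.closure_le]
  rintro γ (rfl | rfl) f hf
  · have hS : (ModularGroup.S : SL(2, ℤ))⁻¹ = -ModularGroup.S := by
      ext i j
      rw [Matrix.SpecialLinearGroup.coe_neg, Matrix.SpecialLinearGroup.coe_inv, ModularGroup.coe_S,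
        Matrix.adjugate_fin_two]
      fin_cases i <;> fin_cases j <;> simp
    refine ⟨comp_mem_thetaSpan (thetaQuot_S_mem hk) hf, ?_⟩
    simp_rw [hS, ModularGroup.SL_neg_smul]
    exact comp_mem_thetaSpan (thetaQuot_S_mem hk) hf
  · constructor
    · have := comp_mem_thetaSpan (thetaQuot_T_zpow_mem hk 1) hf
      simpa using this
    · have := comp_mem_thetaSpan (thetaQuot_T_zpow_mem hk (-1)) hf
      simpa using this

lemma smul_mem_thetaSpan {k : ℕ} (hk : 0 < k) (γ : SL(2, ℤ)) {f : UpperHalfPlane → ℂ}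
    (hf : f ∈ thetaSpan k) : (fun τ => f (γ • τ)) ∈ thetaSpan k := by
  have : γ ∈ stableSubgroup (thetaSpan k) := by rw [stableSubgroup_thetaSpan hk]; trivial
  exact (this f hf).1

/-- The theta exponents lie in `(1/(16k))ℤ` and `η` has period 24; `48k` is a common multiple of
`16k` and 24. -/
lemma thetaSpan_periodic {k : ℕ} (hk : 0 < k) {f : UpperHalfPlane → ℂ} (hf : f ∈ thetaSpan k)
    (τ : UpperHalfPlane) : f (((48 * k : ℕ) : ℝ) +ᵥ τ) = f τ := by
  have hkR : (k : ℝ) ≠ 0 := by exact_mod_cast hk.ne'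
  have hkC : (k : ℂ) ≠ 0 := by exact_mod_cast hk.ne'
  induction hf using Submodule.span_induction with
  | mem f hf =>
    obtain ⟨⟨σ, a⟩, rfl⟩ := hf
    have h := thetaQuot_add (K := 2 * k) (c := 8 * k) (by positivity) σ σ a (48 * k : ℕ) τ
      fun n => ⟨48 * k ^ 2 * n ^ 2 + 24 * k * n * a, by push_cast; field_simp; ring⟩
    have h1 : Complex.exp (Real.pi * Complex.I * a ^ 2 * ((48 * k : ℕ) : ℤ) / ((8 * k : ℝ) : ℂ) -
        Real.pi * Complex.I * ((48 * k : ℕ) : ℤ) / 12) = 1 := by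
      rw [Complex.exp_eq_one_iff]
      refine ⟨3 * a ^ 2 - 2 * k, ?_⟩
      push_cast
      field_simp
      ring
    rw [h1, one_mul] at h
    simp only [UpperHalfPlane.coe_vadd]
    rw [← h, add_comm]
    push_cast
    rfl
  | zero => rfl
  | add f g _ _ hf hg => rw [Pi.add_apply, Pi.add_apply, hf, hg]
  | smul c f _ hf => rw [Pi.smul_apply, Pi.smul_apply, hf]

lemma norm_latticeTheta_le {K : ℕ} (hK : 0 < K) {c : ℝ} (hc : 0 < c) (σ a : ℤ) :
    ∃ B : ℝ, ∀ τ : ℂ, 1 ≤ τ.im → ‖latticeTheta K c σ a τ‖ ≤ B := by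
  have hnorm : ∀ (n : ℤ) (τ : ℂ), ‖(-1) ^ (σ * n) *
      Complex.exp (Real.pi * Complex.I * (2 * K * n + a) ^ 2 * τ / c)‖ =
      Real.exp (-(Real.pi * (2 * K * n + a) ^ 2 / c * τ.im)) := by
    intro n τ
    rw [norm_mul, norm_zpow, norm_neg, norm_one, one_zpow, one_mul, Complex.norm_exp]
    congr 1
    rw [show Real.pi * Complex.I * (2 * K * n + a) ^ 2 * τ / c =
      ((Real.pi * (2 * K * n + a) ^ 2 / c : ℝ) : ℂ) * (Complex.I * τ) by push_cast; ring,
      Complex.re_ofReal_mul]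
    simp
  have hsum := (summable_latticeTheta hK hc σ a (τ := Complex.I) (by simp)).norm
  refine ⟨_, fun τ hτ => tsum_of_norm_bounded hsum.hasSum fun n => ?_⟩
  rw [hnorm, hnorm, Real.exp_le_exp, Complex.I_im, neg_le_neg_iff]
  have := Real.pi_pos
  exact mul_le_mul_of_nonneg_left hτ (by positivity)

/-- Since `Δ = η^24` and `q = O(Δ)`, also `(|q|/|η|)^24 ≤ |q|/|Δ|` is bounded near `i∞`. Thus a
single factor `q` absorbs the pole from `1/η`. -/
lemma norm_exp_div_eta_le : ∃ B A : ℝ, ∀ τ : UpperHalfPlane, A ≤ τ.im →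
    ‖Complex.exp (2 * Real.pi * Complex.I * (τ : ℂ)) / ModularForm.eta τ‖ ≤ B := by
  obtain ⟨C, hC⟩ := ModularForm.exp_isBigO_discriminant.bound
  obtain ⟨A, hA⟩ := (UpperHalfPlane.atImInfty_mem _).mp hC
  refine ⟨max 1 C, A, fun τ hτ => ?_⟩
  have h := hA τ hτ
  have hη := norm_pos_iff.mpr (ModularForm.eta_ne_zero τ.im_pos)
  have hn : ‖Complex.exp (2 * Real.pi * Complex.I * (τ : ℂ))‖ =
      Real.exp (-2 * Real.pi * τ.im) := by
    rw [Complex.norm_exp]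
    congr 1
    simp
  have hle1 : Real.exp (-2 * Real.pi * τ.im) ≤ 1 := by
    rw [Real.exp_le_one_iff]
    have := mul_pos Real.pi_pos τ.im_pos
    linarith
  rw [Set.mem_ofPred_eq, Real.norm_of_nonneg (Real.exp_pos _).le, ModularForm.discriminant,
    norm_pow] at h
  rw [norm_div, hn]
  set x := Real.exp (-2 * Real.pi * τ.im) / ‖ModularForm.eta τ‖ with hx
  have hx0 : 0 ≤ x := by positivity
  have hx24 : x ^ 24 ≤ C := by
    rw [hx, div_pow, div_le_iff₀ (by positivity)]
    refine le_trans ?_ h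
    exact pow_le_of_le_one (Real.exp_pos _).le hle1 (by norm_num)
  rcases le_or_gt x 1 with h1 | h1
  · exact h1.trans (le_max_left _ _)
  · exact ((le_self_pow₀ h1.le (by norm_num)).trans hx24).trans (le_max_right _ _)

lemma thetaSpan_bounded {k : ℕ} (hk : 0 < k) {f : UpperHalfPlane → ℂ} (hf : f ∈ thetaSpan k) :
    UpperHalfPlane.IsBoundedAtImInfty fun τ : UpperHalfPlane =>
      Complex.exp (2 * Real.pi * Complex.I * (1 : ℕ) * (τ : ℂ)) * f τ := by
  have hkR : (k : ℝ) ≠ 0 := by exact_mod_cast hk.ne'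
  simp only [UpperHalfPlane.isBoundedAtImInfty_iff, Nat.cast_one, mul_one]
  induction hf using Submodule.span_induction with
  | mem f hf =>
    obtain ⟨⟨σ, a⟩, rfl⟩ := hf
    obtain ⟨B, hB⟩ := norm_latticeTheta_le (K := 2 * k) (c := 8 * k) (by omega) (by positivity) σ a
    obtain ⟨D, A, hD⟩ := norm_exp_div_eta_le
    refine ⟨D * B, max 1 A, fun τ hτ => ?_⟩
    have h1 := hB τ ((le_max_left _ _).trans hτ)
    have h2 := hD τ ((le_max_right _ _).trans hτ)
    have h3 : Complex.exp (2 * Real.pi * Complex.I * (τ : ℂ)) *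
        thetaQuot (2 * k) (8 * k) σ a τ = Complex.exp (2 * Real.pi * Complex.I * (τ : ℂ)) /
        ModularForm.eta τ * latticeTheta (2 * k) (8 * k) σ a τ := by
      rw [thetaQuot]; ring
    rw [h3, norm_mul]
    exact mul_le_mul h2 h1 (norm_nonneg _) ((norm_nonneg _).trans h2)
  | zero => exact ⟨0, 0, fun τ _ => by simp⟩
  | add f g _ _ hf hg =>
    obtain ⟨M, A, hM⟩ := hf
    obtain ⟨N, B, hN⟩ := hg
    refine ⟨M + N, max A B, fun τ hτ => ?_⟩
    rw [Pi.add_apply, mul_add]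
    exact (norm_add_le _ _).trans (add_le_add (hM τ ((le_max_left _ _).trans hτ))
      (hN τ ((le_max_right _ _).trans hτ)))
  | smul c f _ hf =>
    obtain ⟨M, A, hM⟩ := hf
    refine ⟨‖c‖ * M, A, fun τ hτ => ?_⟩
    rw [Pi.smul_apply, smul_eq_mul, mul_left_comm, norm_mul]
    exact mul_le_mul_of_nonneg_left (hM τ hτ) (norm_nonneg _)

lemma isVectorValuedModularFunction_of_thetaQuot {k d : ℕ} (hk : 0 < k) (s : Fin d → ℕ)
    (hs : ∀ i, s i < k) (hmono : StrictMono s) {G : ℂ → Fin d → ℂ}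
    (hG : ∀ τ : ℂ, 0 < τ.im → ∀ i, G τ i = thetaQuot k (2 * k) 1 (s i) τ)
    {M N : Matrix (Fin d) (Fin d) ℂ} (hM : ∀ τ : ℂ, 0 < τ.im → G (τ + 1) = M.mulVec (G τ))
    (hN : ∀ τ : ℂ, 0 < τ.im → G (τ / (4 * τ + 1)) = N.mulVec (G τ)) :
    IsVectorValuedModularFunction (CongruenceSubgroup.Gamma0 4)
      (fun τ : UpperHalfPlane => G (τ : ℂ)) := by
  have hG' : ∀ (τ : UpperHalfPlane) i, G τ i = thetaQuot k (2 * k) 1 (s i) τ :=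
    fun τ i => hG τ τ.im_pos i
  have hF : ∀ v : Fin d → ℂ, (∀ τ : UpperHalfPlane, v ⬝ᵥ G (τ : ℂ) = 0) → v = 0 := fun v hv =>
    eq_zero_of_sum_thetaQuot_eq_zero s hs hmono fun τ => by
      simpa only [dotProduct, hG'] using hv τ
  have hmem : ∀ i, (fun τ : UpperHalfPlane => G τ i) ∈ thetaSpan k := fun i => by
    simp_rw [hG', ← thetaQuot_two_mul hk]
    exact thetaQuot_mem_thetaSpan k 1 _
  refine ⟨fun i => ?_, exists_representation hF
    (Gamma0_four_le_transformSubgroup hF (fun _ => rfl) hM hN), fun γ => ⟨48 * k, 1, by omega,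
    fun τ => ?_, fun i => ?_⟩⟩
  · simp_rw [hG']
    exact mdifferentiable_thetaQuot hk (by positivity) _ _
  · ext i
    exact thetaSpan_periodic hk (smul_mem_thetaSpan hk γ (hmem i)) τ
  · exact thetaSpan_bounded hk (smul_mem_thetaSpan hk γ (hmem i))

end BressoudVec

end

theorem corollary1p6 (k : ℕ) (hk : 2 ≤ k) :
    (∀ i : ℕ, 1 ≤ i → i ≤ k → ∀ q : ℂ, ‖q‖ < 1 → Summable (BressoudVec.term k i q)) ∧
    (∀ τ : ℂ, 0 < τ.im →
      BressoudVec.X0 k (τ + 1) =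
        (Complex.exp (-(1 / 12) * Real.pi * Complex.I) • BressoudVec.evenT k).mulVec
          (BressoudVec.X0 k τ) ∧
      BressoudVec.X1 k (τ + 1) =
        (Complex.exp (-(1 / 12) * Real.pi * Complex.I) • BressoudVec.Lam k).mulVec
          (BressoudVec.X1 k τ) ∧
      BressoudVec.X0 k (τ / (4 * τ + 1)) =
        ((4 / (k : ℂ) * Complex.exp (Real.pi * Complex.I / 3)) •
          (BressoudVec.matB k * BressoudVec.LamTilde k * BressoudVec.matC k)).mulVec
          (BressoudVec.X0 k τ) ∧
      BressoudVec.X1 k (τ / (4 * τ + 1)) =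
        ((4 / (k : ℂ) * Complex.exp (Real.pi * Complex.I / 3)) •
          (BressoudVec.matA k * (BressoudVec.Lam k)⁻¹ * BressoudVec.matA k)).mulVec
          (BressoudVec.X1 k τ)) ∧
    BressoudVec.IsVectorValuedModularFunction (CongruenceSubgroup.Gamma0 4)
      (fun τ : UpperHalfPlane => BressoudVec.X0 k (τ : ℂ)) ∧
    BressoudVec.IsVectorValuedModularFunction (CongruenceSubgroup.Gamma0 4)
      (fun τ : UpperHalfPlane => BressoudVec.X1 k (τ : ℂ)) := by
  have hk0 : 0 < k := by omega
  refine ⟨fun i _ _ q hq => ?_, fun τ hτ => ⟨BressoudVec.X0_add_one hk hτ,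
    BressoudVec.X1_add_one hk hτ, BressoudVec.X0_div_four_mul_add_one hk hτ,
    BressoudVec.X1_div_four_mul_add_one hk hτ⟩, ?_, ?_⟩
  · obtain ⟨d, rfl⟩ : ∃ d, k = d + 1 := ⟨k - 1, by omega⟩
    exact BressoudVec.summable_term d i hq
  · exact BressoudVec.isVectorValuedModularFunction_of_thetaQuot hk0
      (fun j : Fin ((k + 1) / 2) => 2 * (j : ℕ)) (fun j => by have := j.isLt; omega)
      (fun i j h => by have : (i : ℕ) < j := h; show 2 * (i : ℕ) < 2 * (j : ℕ); omega)
      (fun τ hτ j => by rw [BressoudVec.X0_apply hk hτ]; push_cast; rfl)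
      (fun τ hτ => BressoudVec.X0_add_one hk hτ)
      (fun τ hτ => BressoudVec.X0_div_four_mul_add_one hk hτ)
  · exact BressoudVec.isVectorValuedModularFunction_of_thetaQuot hk0
      (fun j : Fin (k / 2) => 2 * (j : ℕ) + 1) (fun j => by have := j.isLt; omega)
      (fun i j h => by have : (i : ℕ) < j := h; show 2 * (i : ℕ) + 1 < 2 * (j : ℕ) + 1; omega)
      (fun τ hτ j => by rw [BressoudVec.X1_apply hk hτ]; push_cast; rfl)
      (fun τ hτ => BressoudVec.X1_add_one hk hτ)
      (fun τ hτ => BressoudVec.X1_div_four_mul_add_one hk hτ)
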